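/- Let $K$ be a field, $m\ge 0$, $V=K^m$, $q\in K^\times$, $\hbar\in K$. For a matrix $X=\|X_i^j\|$ the lower index numbers the rows; $X_1=X\otimes I$; subscripts on operators label the tensor factors in which they act, and $P$ is the flip. Let $R:V^{\otimes 2}\to V^{\otimes 2}$ be an invertible operator satisfying the braid relation $R_{12}R_{23}R_{12}=R_{23}R_{12}R_{23}$ and the Hecke condition $(R-qI)(R+q^{-1}I)=0$, and assume that $R$ is skew-invertible, i.e. there is an operator $\Psi:V^{\otimes2}\to V^{\otimes2}$ with $\mathrm{Tr}_2R_{12}\Psi_{23}=\mathrm{Tr}_2\Psi_{12}R_{23}=P_{13}$. Put $B=\mathrm{Tr}_1\Psi_{12}$, $C=\mathrm{Tr}_2\Psi_{12}$, assume that $B$ is invertible, and put $$\nu=1-(q-q^{-1})\mathrm{Tr}\,B,\qquad \hat\Psi_{12}=\Psi_{21}+(q-q^{-1})\,\nu^{-1}B_1C_2$$ (if $\mathrm{Tr}\,B=q^{-m}\frac{q^m-q^{-m}}{q-q^{-1}}$, then $\nu^{-1}=q^{2m}$). Let $\mathcal N$ be the modified Reflection Equation algebra, i.e. the unital associative algebra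 with generators $n_i^j$ $(1\le i,j\le m)$, $N=\|n_i^j\|$, and relations $RN_1RN_1-N_1RN_1R=\hbar(RN_1-N_1R)$. Let $\mathcal D$ be the unital algebra with generators $\partial_i^j$, $D=\|\partial_i^j\|$, and relations $R^{-1}D_1R^{-1}D_1-D_1R^{-1}D_1R^{-1}=0$, and let $\varepsilon:\mathcal D\to K$ be the algebra map that kills all $\partial_i^j$. Let $\mathcal W$ (the braided Weyl algebra) be the unital algebra with generators $n_i^j,\partial_i^j$, the above relations of $\mathcal N$ and of $\mathcal D$, and the permutation relations $D_1RN_1R-RN_1R^{-1}D_1=R+\hbar D_1R$. Let $\bigwedge_q$ be the unital algebra generated by symbols $dn_i^j$ with the relations $R\,\Omega_1\hat\Psi_{12}\Omega_1+\Omega_1\hat\Psi_{12}\Omega_1R^{-1}=0$, where $\Omega_i^j=\sum_k(B^{-1})_i^k\,dn_k^j$; let $\bigwedge_q^k$ be its component of degree $k$, and let $\mathfrak D_q^k=\bigwedge_q^k\otimes\mathcal N$. Then the multiplication map $\mathcal N\otimes\mathcal D\to\mathcal W$, $f\otimes x\mapsto fx$, is bijective, so that the braided partial derivatives $\partial_i^j:\mathcal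 N\to\mathcal N$ are well defined: $\partial_i^j(f)$ is obtained by writing the product $\partial_i^jf\in\mathcal W$ as an element of $\mathcal N\otimes\mathcal D$ and applying $\mathrm{id}\otimes\varepsilon$. Moreover, the braided de Rham operator $$d:\mathfrak D_q^k\to\mathfrak D_q^{k+1},\qquad d(\omega\otimes f)=\sum_{i,j}\omega\,\Omega_i^j\otimes\partial_j^i(f),$$ satisfies $d^2=0$, i.e. the composition $\mathfrak D_q^k\to\mathfrak D_q^{k+1}\to\mathfrak D_q^{k+2}$ vanishes for every $k\ge0$. -/

import Mathlib

open scoped TensorProduct Kronecker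

namespace BraidedDeRham

/-! An operator on `V ⊗ V`, with `V` having a basis indexed by `ι`, is a matrix indexed by `ι × ι`;
the first (row) index is the lower index and the second (column) index is the upper one, so that
`R (i, j) (k, l)` stands for `R_{ij}^{kl}` and `N i j` for `n_i^j`. -/

section Braidings

variable {K : Type*} [Field K] {ι : Type*} [Fintype ι] [DecidableEq ι]

/-- `M ⊗ I`, the operator `M` acting in the first two factors of `V ⊗ V ⊗ V`. -/
def leg12 (M : Matrix (ι × ι) (ι × ι) K) : Matrix (ι × ι × ι) (ι × ι × ι) K :=
  fun x y => if x.2.2 = y.2.2 then M (x.1, x.2.1) (y.1, y.2.1) else 0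

/-- `I ⊗ M`, the operator `M` acting in the last two factors of `V ⊗ V ⊗ V`. -/
def leg23 (M : Matrix (ι × ι) (ι × ι) K) : Matrix (ι × ι × ι) (ι × ι × ι) K :=
  fun x y => if x.1 = y.1 then M x.2 y.2 else 0

/-- The partial trace over the middle factor of `V ⊗ V ⊗ V`. -/
def trMid (M : Matrix (ι × ι × ι) (ι × ι × ι) K) : Matrix (ι × ι) (ι × ι) K :=
  fun x y => ∑ a, M (x.1, a, x.2) (y.1, a, y.2)

/-- The usual flip `P`. -/
def flipOp : Matrix (ι × ι) (ι × ι) K :=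
  fun x y => if x.1 = y.2 ∧ x.2 = y.1 then 1 else 0

/-- `R` is an invertible solution of the braid relation subject to the Hecke condition
`(R - q I) (R + q⁻¹ I) = 0`. -/
structure IsHeckeSymmetry (R : Matrix (ι × ι) (ι × ι) K) (q : K) : Prop where
  invertible : IsUnit R
  braid : leg12 R * leg23 R * leg12 R = leg23 R * leg12 R * leg23 R
  hecke : (R - q • (1 : Matrix (ι × ι) (ι × ι) K)) *
    (R + q⁻¹ • (1 : Matrix (ι × ι) (ι × ι) K)) = 0

/-- `Ψ` is the skew-inverse of `R`: `Tr₂ R₁₂ Ψ₂₃ = Tr₂ Ψ₁₂ R₂₃ = P₁₃`. -/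
structure IsSkewInverse (R Ψ : Matrix (ι × ι) (ι × ι) K) : Prop where
  left : trMid (leg12 R * leg23 Ψ) = flipOp
  right : trMid (leg12 Ψ * leg23 R) = flipOp

/-- `B = Tr₁ Ψ₁₂`. -/
def opB (Ψ : Matrix (ι × ι) (ι × ι) K) : Matrix ι ι K :=
  fun j l => ∑ i, Ψ (i, j) (i, l)

/-- `C = Tr₂ Ψ₁₂`. -/
def opC (Ψ : Matrix (ι × ι) (ι × ι) K) : Matrix ι ι K :=
  fun i k => ∑ j, Ψ (i, j) (k, j)

/-- The scalar `ν = 1 - (q - q⁻¹) Tr B`, which is the scalar of the operator `B C = ν I`. -/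
def nu (Ψ : Matrix (ι × ι) (ι × ι) K) (q : K) : K :=
  1 - (q - q⁻¹) * (opB Ψ).trace

/-- If `Tr B = q⁻ᵐ m_q` with `m_q = (q^m - q⁻ᵐ) / (q - q⁻¹)`, then `ν⁻¹ = q^(2m)`. -/
theorem nu_inv_eq (Ψ : Matrix (ι × ι) (ι × ι) K) (q : K) (m : ℕ) (hq : q ≠ 0)
    (hq' : q - q⁻¹ ≠ 0)
    (h : (opB Ψ).trace = (q ^ m)⁻¹ * ((q ^ m - (q ^ m)⁻¹) / (q - q⁻¹))) :
    (nu Ψ q)⁻¹ = q ^ (2 * m) := by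
  have hm : q ^ m ≠ 0 := pow_ne_zero _ hq
  have h1 : nu Ψ q = (q ^ (2 * m))⁻¹ := by
    have h2 : (q - q⁻¹) * ((q ^ m)⁻¹ * ((q ^ m - (q ^ m)⁻¹) / (q - q⁻¹)))
        = (q ^ m)⁻¹ * (q ^ m - (q ^ m)⁻¹) := by
      rw [mul_div_assoc', mul_div_assoc', mul_div_assoc]
      rw [mul_div_assoc', mul_comm (q - q⁻¹), mul_div_cancel_right₀ _ hq']
    rw [nu, h, h2, mul_sub, inv_mul_cancel₀ hm, sub_sub_cancel, ← mul_inv, ← pow_add, two_mul]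
  rw [h1, inv_inv]

/-- `Ψ̂₁₂ = Ψ₂₁ + (q - q⁻¹) ν⁻¹ B₁ C₂`. -/
def hatPsi (Ψ : Matrix (ι × ι) (ι × ι) K) (q : K) : Matrix (ι × ι) (ι × ι) K :=
  Ψ.submatrix Prod.swap Prod.swap + ((q - q⁻¹) * (nu Ψ q)⁻¹) • (opB Ψ ⊗ₖ opC Ψ)

end Braidings

section Relations

variable {K : Type*} [Field K] {ι : Type*} [Fintype ι] [DecidableEq ι]
  {A : Type*} [Ring A] [Algebra K A] {A' : Type*} [Ring A'] [Algebra K A']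

/-- `X ⊗ I` for a matrix `X` with entries in an algebra. -/
def leg1 (X : Matrix ι ι A) : Matrix (ι × ι) (ι × ι) A := X ⊗ₖ (1 : Matrix ι ι A)

/-- A scalar matrix viewed as a matrix over the `K`-algebra `A`. -/
def scal (A : Type*) [Ring A] [Algebra K A] {n : Type*} (M : Matrix n n K) : Matrix n n A :=
  M.map (algebraMap K A)

/-- `R N₁ R N₁ - N₁ R N₁ R - ħ (R N₁ - N₁ R)`. -/
def mREMatrix (R : Matrix (ι × ι) (ι × ι) K) (ħ : K) (N : Matrix ι ι A) :
    Matrix (ι × ι) (ι × ι) A :=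
  scal A R * leg1 N * scal A R * leg1 N - leg1 N * scal A R * leg1 N * scal A R
    - ħ • (scal A R * leg1 N - leg1 N * scal A R)

/-- `R⁻¹ D₁ R⁻¹ D₁ - D₁ R⁻¹ D₁ R⁻¹`. -/
noncomputable def derMatrix (R : Matrix (ι × ι) (ι × ι) K) (D : Matrix ι ι A) :
    Matrix (ι × ι) (ι × ι) A :=
  scal A R⁻¹ * leg1 D * scal A R⁻¹ * leg1 D - leg1 D * scal A R⁻¹ * leg1 D * scal A R⁻¹

/-- `D₁ R N₁ R - R N₁ R⁻¹ D₁ - R - ħ D₁ R`. -/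
noncomputable def permMatrix (R : Matrix (ι × ι) (ι × ι) K) (ħ : K) (N D : Matrix ι ι A) :
    Matrix (ι × ι) (ι × ι) A :=
  leg1 D * scal A R * leg1 N * scal A R - scal A R * leg1 N * scal A R⁻¹ * leg1 D
    - scal A R - ħ • (leg1 D * scal A R)

/-- `R Ω₁ Ψ̂ Ω₁ + Ω₁ Ψ̂ Ω₁ R⁻¹`. -/
noncomputable def skewMatrix (R Ψh : Matrix (ι × ι) (ι × ι) K) (Ω : Matrix ι ι A) :
    Matrix (ι × ι) (ι × ι) A :=
  scal A R * leg1 Ω * scal A Ψh * leg1 Ω + leg1 Ω * scal A Ψh * leg1 Ω * scal A R⁻¹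

theorem leg1_map (φ : A →ₐ[K] A') (X : Matrix ι ι A) :
    (leg1 X).map φ = leg1 (X.map φ) := by
  ext x y
  simp [leg1, Matrix.kroneckerMap_apply, Matrix.one_apply, apply_ite φ]

theorem scal_map (φ : A →ₐ[K] A') {n : Type*} (M : Matrix n n K) :
    (scal A M).map φ = scal A' M := by
  ext x y
  simp [scal]

theorem mREMatrix_map (φ : A →ₐ[K] A') (R : Matrix (ι × ι) (ι × ι) K) (ħ : K)
    (N : Matrix ι ι A) : (mREMatrix R ħ N).map φ = mREMatrix R ħ (N.map φ) := by
  have h : ∀ M : Matrix (ι × ι) (ι × ι) A, M.map φ = φ.mapMatrix M := fun _ => rfl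
  have h1 := leg1_map φ N
  have h2 := scal_map φ R
  rw [h] at h1 h2
  rw [h, mREMatrix, mREMatrix]
  simp only [map_sub, map_mul, map_smul, h1, h2]

theorem derMatrix_map (φ : A →ₐ[K] A') (R : Matrix (ι × ι) (ι × ι) K)
    (D : Matrix ι ι A) : (derMatrix R D).map φ = derMatrix R (D.map φ) := by
  have h : ∀ M : Matrix (ι × ι) (ι × ι) A, M.map φ = φ.mapMatrix M := fun _ => rfl
  have h1 := leg1_map φ D
  have h2 := scal_map φ R⁻¹
  rw [h] at h1 h2
  rw [h, derMatrix, derMatrix]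
  simp only [map_sub, map_mul, h1, h2]

end Relations

section Algebras

variable {K : Type*} [Field K] {ι : Type*} [Fintype ι] [DecidableEq ι]

/-- The matrix of free generators. -/
def freeGen (K : Type*) [Field K] (ι : Type*) : Matrix ι ι (FreeAlgebra K (ι × ι)) :=
  fun i j => FreeAlgebra.ι K (i, j)

/-- The matrix of the free generators `n_i^j` among the generators `n_i^j`, `∂_i^j`. -/
def freeN (K : Type*) [Field K] (ι : Type*) : Matrix ι ι (FreeAlgebra K (ι × ι ⊕ ι × ι)) :=
  fun i j => FreeAlgebra.ι K (Sum.inl (i, j))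

/-- The matrix of the free generators `∂_i^j` among the generators `n_i^j`, `∂_i^j`. -/
def freeD (K : Type*) [Field K] (ι : Type*) : Matrix ι ι (FreeAlgebra K (ι × ι ⊕ ι × ι)) :=
  fun i j => FreeAlgebra.ι K (Sum.inr (i, j))

/-- The defining relations of the modified Reflection Equation algebra. -/
def mRERel (R : Matrix (ι × ι) (ι × ι) K) (ħ : K) (x y : FreeAlgebra K (ι × ι)) : Prop :=
  y = 0 ∧ ∃ a b, x = mREMatrix R ħ (freeGen K ι) a b

/-- The modified Reflection Equation algebra `N(q, ħ)`. -/
abbrev MREAlg (R : Matrix (ι × ι) (ι × ι) K) (ħ : K) := RingQuot (mRERel R ħ)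

/-- The defining relations of the algebra of partial derivatives. -/
def derRel (R : Matrix (ι × ι) (ι × ι) K) (x y : FreeAlgebra K (ι × ι)) : Prop :=
  y = 0 ∧ ∃ a b, x = derMatrix R (freeGen K ι) a b

/-- The algebra `𝒟` generated by the partial derivatives `∂_i^j`. -/
abbrev DerAlg (R : Matrix (ι × ι) (ι × ι) K) := RingQuot (derRel R)

/-- The defining relations of the braided Weyl algebra: those of `N(q, ħ)`, those of `𝒟`, and
the permutation relations. -/
def weylRel (R : Matrix (ι × ι) (ι × ι) K) (ħ : K)
    (x y : FreeAlgebra K (ι × ι ⊕ ι × ι)) : Prop :=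
  y = 0 ∧ ∃ a b, x = mREMatrix R ħ (freeN K ι) a b ∨ x = derMatrix R (freeD K ι) a b ∨
    x = permMatrix R ħ (freeN K ι) (freeD K ι) a b

/-- The braided Weyl algebra `W(N(q, ħ))`. -/
abbrev WeylAlg (R : Matrix (ι × ι) (ι × ι) K) (ħ : K) := RingQuot (weylRel R ħ)

/-- The generator `n_i^j` of the braided Weyl algebra. -/
def weylN (R : Matrix (ι × ι) (ι × ι) K) (ħ : K) : Matrix ι ι (WeylAlg R ħ) :=
  (freeN K ι).map (RingQuot.mkAlgHom K (weylRel R ħ))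

/-- The generator `∂_i^j` of the braided Weyl algebra. -/
def weylD (R : Matrix (ι × ι) (ι × ι) K) (ħ : K) : Matrix ι ι (WeylAlg R ħ) :=
  (freeD K ι).map (RingQuot.mkAlgHom K (weylRel R ħ))

theorem weyl_mRE (R : Matrix (ι × ι) (ι × ι) K) (ħ : K) : mREMatrix R ħ (weylN R ħ) = 0 := by
  rw [weylN, ← mREMatrix_map]
  ext a b
  rw [Matrix.map_apply, Matrix.zero_apply, ← map_zero (RingQuot.mkAlgHom K (weylRel R ħ))]
  exact RingQuot.mkAlgHom_rel K ⟨rfl, a, b, Or.inl rfl⟩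

theorem weyl_der (R : Matrix (ι × ι) (ι × ι) K) (ħ : K) : derMatrix R (weylD R ħ) = 0 := by
  rw [weylD, ← derMatrix_map]
  ext a b
  rw [Matrix.map_apply, Matrix.zero_apply, ← map_zero (RingQuot.mkAlgHom K (weylRel R ħ))]
  exact RingQuot.mkAlgHom_rel K ⟨rfl, a, b, Or.inr (Or.inl rfl)⟩

/-- An algebra map out of `N(q, ħ)`, given by a matrix that satisfies its relations. -/
def mRELift {A : Type*} [Ring A] [Algebra K A] (R : Matrix (ι × ι) (ι × ι) K) (ħ : K)
    (N : Matrix ι ι A) (hN : mREMatrix R ħ N = 0) : MREAlg R ħ →ₐ[K] A :=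
  RingQuot.liftAlgHom K ⟨FreeAlgebra.lift K fun p => N p.1 p.2, by
    rintro x y ⟨rfl, a, b, rfl⟩
    have h1 : (freeGen K ι).map (FreeAlgebra.lift K fun p : ι × ι => N p.1 p.2) = N := by
      ext i j
      simp [freeGen]
    have h := mREMatrix_map (FreeAlgebra.lift K fun p : ι × ι => N p.1 p.2) R ħ (freeGen K ι)
    rw [h1, hN] at h
    rw [map_zero]
    exact congrFun (congrFun h a) b⟩

/-- An algebra map out of `𝒟`, given by a matrix that satisfies its relations. -/
def derLift {A : Type*} [Ring A] [Algebra K A] (R : Matrix (ι × ι) (ι × ι) K)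
    (D : Matrix ι ι A) (hD : derMatrix R D = 0) : DerAlg R →ₐ[K] A :=
  RingQuot.liftAlgHom K ⟨FreeAlgebra.lift K fun p => D p.1 p.2, by
    rintro x y ⟨rfl, a, b, rfl⟩
    have h1 : (freeGen K ι).map (FreeAlgebra.lift K fun p : ι × ι => D p.1 p.2) = D := by
      ext i j
      simp [freeGen]
    have h := derMatrix_map (FreeAlgebra.lift K fun p : ι × ι => D p.1 p.2) R (freeGen K ι)
    rw [h1, hD] at h
    rw [map_zero]
    exact congrFun (congrFun h a) b⟩

/-- The algebra map `N(q, ħ) → W(N(q, ħ))`, `n_i^j ↦ n_i^j`. -/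
def inclN (R : Matrix (ι × ι) (ι × ι) K) (ħ : K) : MREAlg R ħ →ₐ[K] WeylAlg R ħ :=
  mRELift R ħ (weylN R ħ) (weyl_mRE R ħ)

/-- The algebra map `𝒟 → W(N(q, ħ))`, `∂_i^j ↦ ∂_i^j`. -/
def inclD (R : Matrix (ι × ι) (ι × ι) K) (ħ : K) : DerAlg R →ₐ[K] WeylAlg R ħ :=
  derLift R (weylD R ħ) (weyl_der R ħ)

/-- The counit of `𝒟`: the algebra map to `K` that kills all generators `∂_i^j`. -/
def counit (R : Matrix (ι × ι) (ι × ι) K) : DerAlg R →ₐ[K] K :=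
  derLift R 0 (by simp [derMatrix, leg1])

/-- The multiplication map `N(q, ħ) ⊗ 𝒟 → W(N(q, ħ))`, `f ⊗ x ↦ f x`. -/
def weylMul (R : Matrix (ι × ι) (ι × ι) K) (ħ : K) :
    MREAlg R ħ ⊗[K] DerAlg R →ₗ[K] WeylAlg R ħ :=
  LinearMap.mul' K (WeylAlg R ħ) ∘ₗ
    TensorProduct.map (inclN R ħ).toLinearMap (inclD R ħ).toLinearMap

end Algebras

section DeRham

variable {K : Type*} [Field K] {ι : Type*} [Fintype ι] [DecidableEq ι]

/-- The braided partial derivative `∂_i^j` as an operator on `N(q, ħ)`: by means of the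
permutation relations write the product `∂_i^j f` as an element of `N(q, ħ) ⊗ 𝒟`, then apply the
counit to the right factor. -/
noncomputable def braidedPartial (R : Matrix (ι × ι) (ι × ι) K) (ħ : K)
    (hW : Function.Bijective (weylMul R ħ)) (i j : ι) : MREAlg R ħ →ₗ[K] MREAlg R ħ :=
  (TensorProduct.rid K (MREAlg R ħ)).toLinearMap ∘ₗ
    LinearMap.lTensor (MREAlg R ħ) (counit R).toLinearMap ∘ₗ
    (LinearEquiv.ofBijective (weylMul R ħ) hW).symm.toLinearMap ∘ₗ
    LinearMap.mulLeft K (weylD R ħ i j) ∘ₗ (inclN R ħ).toLinearMap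

/-- The defining relations of `⋀_q`, where the free generators are the differentials `dn_i^j`
and `Ω = B⁻¹ dN`. -/
def extRel (R Ψ : Matrix (ι × ι) (ι × ι) K) (q : K) (x y : FreeAlgebra K (ι × ι)) : Prop :=
  y = 0 ∧ ∃ a b, x = skewMatrix R (hatPsi Ψ q)
    (scal (FreeAlgebra K (ι × ι)) (opB Ψ)⁻¹ * freeGen K ι) a b

/-- The braided exterior algebra `⋀_q`. -/
abbrev ExtAlg (R Ψ : Matrix (ι × ι) (ι × ι) K) (q : K) := RingQuot (extRel R Ψ q)

/-- The differential `dn_i^j` in `⋀_q`. -/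
def dn (R Ψ : Matrix (ι × ι) (ι × ι) K) (q : K) : Matrix ι ι (ExtAlg R Ψ q) :=
  (freeGen K ι).map (RingQuot.mkAlgHom K (extRel R Ψ q))

/-- `Ω_i^j = (B⁻¹)_i^k dn_k^j` in `⋀_q`. -/
noncomputable def Omega (R Ψ : Matrix (ι × ι) (ι × ι) K) (q : K) : Matrix ι ι (ExtAlg R Ψ q) :=
  fun i j => ∑ k, (opB Ψ)⁻¹ i k • dn R Ψ q k j

/-- The homogeneous component of degree `k` of `⋀_q`, spanned by the products of `k`
differentials. -/
def extPart (R Ψ : Matrix (ι × ι) (ι × ι) K) (q : K) (k : ℕ) : Submodule K (ExtAlg R Ψ q) :=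
  Submodule.span K (Set.range fun p : ι × ι => dn R Ψ q p.1 p.2) ^ k

theorem mul_Omega_mem (R Ψ : Matrix (ι × ι) (ι × ι) K) (q : K) (k : ℕ) (i j : ι)
    (x : ExtAlg R Ψ q) (hx : x ∈ extPart R Ψ q k) :
    LinearMap.mulRight K (Omega R Ψ q i j) x ∈ extPart R Ψ q (k + 1) := by
  rw [LinearMap.mulRight_apply, extPart, pow_succ]
  refine Submodule.mul_mem_mul hx (Submodule.sum_mem _ fun l _ => Submodule.smul_mem _ _ ?_)
  exact Submodule.subset_span ⟨(l, j), rfl⟩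

/-- The map `⋀_q^k → ⋀_q^{k+1}`, `ω ↦ ω Ω_i^j`. -/
noncomputable def mulOmega (R Ψ : Matrix (ι × ι) (ι × ι) K) (q : K) (k : ℕ) (i j : ι) :
    extPart R Ψ q k →ₗ[K] extPart R Ψ q (k + 1) :=
  (LinearMap.mulRight K (Omega R Ψ q i j)).restrict (mul_Omega_mem R Ψ q k i j)

/-- The braided `k`-differentials `⋀_q^k ⊗ N(q, ħ)`. -/
abbrev BraidedForms (R Ψ : Matrix (ι × ι) (ι × ι) K) (q ħ : K) (k : ℕ) :=
  extPart R Ψ q k ⊗[K] MREAlg R ħ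

/-- The braided de Rham operator
`d (ω ⊗ f) = ∑ i j, ω Ω_i^j ⊗ ∂_j^i (f)` on braided `k`-differentials. -/
noncomputable def deRham (R Ψ : Matrix (ι × ι) (ι × ι) K) (q ħ : K)
    (hW : Function.Bijective (weylMul R ħ)) (k : ℕ) :
    BraidedForms R Ψ q ħ k →ₗ[K] BraidedForms R Ψ q ħ (k + 1) :=
  ∑ i, ∑ j, TensorProduct.map (mulOmega R Ψ q k i j) (braidedPartial R ħ hW j i)

end DeRham

end BraidedDeRham

/-! Bijectivity of the multiplication map is a PBW statement. The permutation relations contain the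
contraction of the products of a derivative and a generator with `R`; since `R` is skew-invertible,
the contraction can be undone (`IsSkewInverse.eq_sum`), so derivatives can be moved to the right and
the products `f x` span `𝒲`. For injectivity an action of `𝒲` on `𝒩 ⊗ 𝒟` is built in which `f x`
sends `1 ⊗ 1` to `f ⊗ x`. Moving the row vector `(1, ∂)` past a generator gives a matrix over `𝒩`.
These matrices satisfy the relations of `𝒩` (`derivative_past_mRE`, `shiftX_rel`), and the resulting
operators of the derivatives satisfy the relations of `𝒟`: the defect annihilates `1 ⊗ x`, and
`commutator_past_generator` shows that this persists when generators are multiplied on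
(`op_derComm`).

For `d² = 0`, put `Y = Ω₁ Ψ̂ Ω₁`. The relations of the exterior algebra say `Y + R Y R = 0`. On the
other side, for each `f` there is a matrix `X` with `D₁ R⁻¹ D₁ f ≡ X + R X R` modulo the left ideal
generated by the derivatives (`derProd_mem`). Hence the trace pairing of the two is `Tr Y (X + R X
R) = Tr (Y + R Y R) X = 0` (`tensorTrace_eq_zero`). Because `Ψ̂` is a skew-inverse of `R⁻¹`
(`hatPsi_sum`), the same trace equals `∑ Ω_i^j Ω_k^l ⊗ ∂_l^k ∂_j^i f`, which is the coefficient of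
`d²` (`tensorTrace_hatPsi`).

If `1 + R²` is invertible, that is `q² ≠ -1`, then `X` could be found by dividing `D₁ R⁻¹ D₁ f` by
`1 + R²`, as it commutes with `R`. The induction on `f` avoids this restriction: by
`derivatives_past_generator`, passing a generator creates the terms `R₁₂⁻¹ D₁ R₂₃ + D₁ R₂₃ R₁₂`,
which already have the shape `X + R X R`. -/

namespace BraidedDeRham

/-! ### Consequences of the braid and Hecke relations in an abstract algebra. -/

section RingIdentities

variable {K S : Type*} [Field K] [Ring S] [Algebra K S]

theorem comm_of_inverse {b b' x : S} (hb : b * b' = 1) (hb' : b' * b = 1)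
    (h : b * x = x * b) : b' * x = x * b' := by
  linear_combination (norm := noncomm_ring) - b' * x * hb - b' * h * b' + hb' * x * b'

theorem inv_braid_conj {a b a' b' : S} (ha' : a' * a = 1) (hb : b * b' = 1)
    (hab : a * b * a = b * a * b) : a' * b * a = b * a * b' := by
  linear_combination (norm := noncomm_ring) (-a') * hab * b' + ha' * b * a * b' -
    a' * b * a * hb

theorem inv_braid {a b a' b' : S}
    (ha : a * a' = 1) (ha' : a' * a = 1) (hb : b * b' = 1) (hb' : b' * b = 1)
    (hab : a * b * a = b * a * b) : a' * b' * a' = b' * a' * b' := by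
  linear_combination (norm := noncomm_ring) - a' * b' * a' * hb - a' * b' * a' * b * ha * b'
    - a' * b' * a' * b * a * hb * a' * b' - a' * b' * a' * hab * b' * a' * b'
    + a' * b' * ha' * b * a * b' * a' * b' + a' * hb' * a * b' * a' * b' + ha' * b' * a' * b'

/-- Moving a derivative past the quadratic-linear relations of the reflection equation type. -/
theorem derivative_past_mRE {a b a' b' d u n n' : S} (h : K)
    (ha : a * a' = 1) (ha' : a' * a = 1) (hb : b * b' = 1) (hb' : b' * b = 1)
    (hl : a - a' = b - b') (hab : a * b * a = b * a * b)
    (hbn : b * n = n * b) (hbn' : b * n' = n' * b) (hbd : b * d = d * b)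
    (hau : a * u = u * a) (hbu : b * u = u * b) (hun : u * n' = n * u)
    (H : d * a * n' * a = a * n * a' * d + u * a + h • (d * a)) :
    d * (a * b * (a * n' * a * n' - n' * a * n' * a - h • (a * n' - n' * a)) * b * a) =
      a * b * (a * n * a * n - n * a * n * a - h • (a * n - n * a)) * b' * a' * d := by
  have hbn2 := comm_of_inverse hb hb' hbn
  have hbd2 := comm_of_inverse hb hb' hbd
  have w1 := inv_braid_conj ha' hb hab
  have w2 := inv_braid ha ha' hb hb' hab
  have hla : (b - b') * a = a * (b - b') := by
    linear_combination (norm := noncomm_ring) -hl * a - ha' + ha + a * hl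
  have hla' : (b - b') * a' = a' * (b - b') := by
    linear_combination (norm := noncomm_ring) -hl * a' - ha' + ha + a' * hl
  have hln : (b - b') * n = n * (b - b') := by
    linear_combination (norm := noncomm_ring) hbn - hbn2
  have hld : (b - b') * d = d * (b - b') := by
    linear_combination (norm := noncomm_ring) hbd - hbd2
  -- The `t` identities bring each monomial to a form with the block `d a n' a`, to which `H`
  -- applies; the suffixes `a` and `c` belong to the second application of `H`.
  have t1 : d * a * b * a * n' * a * n' * b * a = b * (d * a * n' * a) * b * a * n' * a := by
    linear_combination (norm := noncomm_ring) d * hab * n' * a * n' * b * a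
      - hbd * a * b * n' * a * n' * b * a + b * d * a * hbn' * a * n' * b * a
      - b * d * a * n' * b * a * hbn' * a - b * d * a * n' * hab * n' * a
  have t2 : d * a * b * n' * a * n' * a * b * a = (d * a * n' * a) * b * a * n' * a * b := by
    linear_combination (norm := noncomm_ring) d * a * hbn' * a * n' * a * b * a
      + d * a * n' * b * a * n' * hab - d * a * n' * b * a * hbn' * a * b
      - d * a * n' * hab * n' * a * b
  have t3 : d * a * b * a * n' * b * a = b * (d * a * n' * a) * a' * b * b * a := by
    linear_combination (norm := noncomm_ring) d * hab * n' * b * a - hbd * a * b * n' * b * a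
      + b * d * a * hbn' * b * a - b * d * a * n' * ha * b * b * a
  have t4 : d * a * b * n' * a * b * a = (d * a * n' * a) * b * a * a := by
    linear_combination (norm := noncomm_ring) d * a * hbn' * a * b * a - d * a * n' * hab * a
  have t1a : b * a * n * a' * d * b * a * n' * a = b * a * n * a' * b * (d * a * n' * a) := by
    linear_combination (norm := noncomm_ring) - b * a * n * a' * hbd * a * n' * a
  have t1c : b * d * a * b * a * n' * a = b * b * (d * a * n' * a) * a' * b * a := by
    linear_combination (norm := noncomm_ring) b * d * hab * n' * a - b * hbd * a * b * n' * a
      + b * b * d * a * hbn' * a - b * b * d * a * n' * ha * b * a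
  have t2a : a * n * a' * d * b * a * n' * a * b = a * n * a' * b * (d * a * n' * a) * b := by
    linear_combination (norm := noncomm_ring) - a * n * a' * hbd * a * n' * a * b
  have t2c : d * a * b * a * n' * a * b = b * (d * a * n' * a) * b * a := by
    linear_combination (norm := noncomm_ring) d * hab * n' * a * b - hbd * a * b * n' * a * b
      + b * d * a * hbn' * a * b - b * d * a * n' * hab
  have n1 : b * a * n * a' * b * a * n * a' * d = a * b * a * n * a * n * b' * a' * d := by
    linear_combination (norm := noncomm_ring) b * a * n * w1 * n * a' * d
      + b * a * n * b * a * hbn2 * a' * d - b * a * hbn * a * n * b' * a' * d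
      - hab * n * a * n * b' * a' * d
  have n2 : a * n * a' * b * a * n * a' * d * b = a * b * n * a * n * a * b' * a' * d := by
    linear_combination (norm := noncomm_ring) a * n * w1 * n * a' * d * b
      + a * n * b * a * hbn2 * a' * d * b - a * hbn * a * n * b' * a' * d * b
      - a * b * n * a * n * ha * b' * a' * d * b + a * b * n * a * n * a * w2 * d * b
      + a * b * n * a * n * a * b' * a' * hbd2 * b + a * b * n * a * n * a * b' * a' * d * hb'
  -- The terms containing `u` without `h` must cancel. Carrying `u` to the right turns `n'` into `n`
  -- and leaves the coefficient `u0`, which vanishes by the Hecke condition in the form `hl`.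
  have u0 : b * a * n * a' * b * a + b * a * b * a * n * a - a * n * a' * b * a * b
      - a * b * a * n * a * b = 0 := by
    linear_combination (norm := noncomm_ring) a * n * a' * hab - a * n * ha' * b * a
      + a * hbn * a + b * a * n * w1 - b * a * hbn * a * b' - hab * n * a * b'
      - hab * a * n * a + a * b * ha * n * a + a * b * a * hl * n * a + a * b * a * hbn * a
      - a * b * a * hbn2 * a + a * b * a * n * hla
  have u1 : b * a * n * a' * b * u * a + b * u * a * b * a * n' * a
      - a * n * a' * b * u * a * b - u * a * b * a * n' * a * b = 0 := by
    linear_combination (norm := noncomm_ring) u0 * u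
      - b * a * n * a' * b * hau
      - b * hau * b * a * n' * a - b * a * hbu * a * n' * a - b * a * b * hau * n' * a
      + b * a * b * a * hun * a - b * a * b * a * n * hau
      + a * n * a' * b * hau * b + a * n * a' * b * a * hbu
      + hau * b * a * n' * a * b + a * hbu * a * n' * a * b + a * b * hau * n' * a * b
      - a * b * a * hun * a * b + a * b * a * n * hau * b + a * b * a * n * a * hbu
  have hlW : (b - b') * (a * n * a' * d) = (a * n * a' * d) * (b - b') := by
    linear_combination (norm := noncomm_ring) hla * n * a' * d + a * hln * a' * d
      + a * n * hla' * d + a * n * a' * hld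
  have m1 : a * b * a * n * b' * a' * d = b * a * n * a' * d := by
    linear_combination (norm := noncomm_ring) hab * n * b' * a' * d
      + b * a * hbn * b' * a' * d + b * a * n * hb * a' * d
  have m2 : a * b * n * a * b' * a' * d = a * n * a' * d * b := by
    linear_combination (norm := noncomm_ring) a * hbn * a * b' * a' * d - a * n * w1 * a' * d
      + a * n * a' * b * ha * d + a * n * a' * hbd
  have v0 : b * a * a - b * a * b + a' * b * a - b = 0 := by
    linear_combination (norm := noncomm_ring) hab - hl * b * a + hb' * a + b * ha' + b * hl * a
      - hb * a
  -- The terms of first order in `h` that contain both `n` and `d` reproduce the linear part of the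
  -- relation for `n`; the remaining ones, `x1` and `y1`, cancel.
  have v1 : b * a * n * a' * b * d * a + b * b * a * n * a' * d * a' * b * a
      - a * n * a' * b * d * a * b - b * a * n * a' * d * b * a
      - b * a * n * a' * d * a' * b * b * a + a * n * a' * d * b * a * a
      = a * b * n * a * b' * a' * d - a * b * a * n * b' * a' * d := by
    linear_combination (norm := noncomm_ring) m1 - m2 + b * a * n * a' * hbd * a
      - a * n * a' * hbd * a * b + b * hlW * a' * b * a + hb * a * n * a' * d * a' * b * a
      + b * a * n * a' * d * hla' * b * a - b * a * n * a' * d * a' * hb' * a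
      - b * a * n * a' * d * ha' + a * n * a' * d * v0
  have x1 : b * b * u * a * a' * b * a - b * u * a * b * a - b * u * a * a' * b * b * a
      + u * a * b * a * a = 0 := by
    linear_combination (norm := noncomm_ring) b * b * u * ha * b * a - b * u * ha * b * b * a
      + b * hbu * b * a - hbu * a * b * a + u * hab * a
  have y1 : b * b * d * a * a' * b * a - b * d * a * b * a - b * d * a * a' * b * b * a
      + d * a * b * a * a = 0 := by
    linear_combination (norm := noncomm_ring) b * b * d * ha * b * a - b * d * ha * b * b * a
      + b * hbd * b * a - hbd * a * b * a + d * hab * a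
  linear_combination (norm := (simp only [mul_add, add_mul, mul_sub, sub_mul, smul_mul_assoc,
      mul_smul_comm, smul_add, smul_sub, mul_assoc, smul_zero]; module))
    t1 + b * H * b * a * n' * a + t1a + b * a * n * a' * b * H
      + h • t1c + h • (b * b * H * a' * b * a)
      - t2 - H * b * a * n' * a * b - t2a - a * n * a' * b * H * b
      - h • t2c - h • (b * H * b * a)
      - h • t3 - h • (b * H * a' * b * b * a) + h • t4 + h • (H * b * a * a)
      + n1 - n2 + u1 + h • v1 + h • x1 + h • h • y1

/-- Moving a product of two derivatives past a generator. -/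
theorem derivatives_past_generator {a b a' b' d n : S} (h : K)
    (ha : a * a' = 1) (ha' : a' * a = 1) (hb : b * b' = 1) (hb' : b' * b = 1)
    (hab : a * b * a = b * a * b)
    (hbn : b * n = n * b) (hbd : b * d = d * b)
    (H : d * a * n * a = a * n * a' * d + a + h • (d * a)) :
    (d * a' * d) * (b * a * n * a * b) = (b * a * n * a' * b') * (d * a' * d) +
      a' * d * b + d * b * a + h • ((d * a' * d) * (b + a * b * a)) := by
  have hbn2 := comm_of_inverse hb hb' hbn
  have hbd2 := comm_of_inverse hb hb' hbd
  have w1 := inv_braid_conj ha' hb hab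
  have w2 := inv_braid ha ha' hb hb' hab
  have e1 : (d * a' * d) * (b * a * n * a * b) = d * a' * b * (d * a * n * a) * b := by
    linear_combination (norm := noncomm_ring) - d * a' * hbd * a * n * a * b
  have e2 : d * a' * b * (a * n * a' * d) * b = b * (d * a * n * a) * b' * a' * d := by
    linear_combination (norm := noncomm_ring) d * w1 * n * a' * d * b
      - hbd * a * b' * n * a' * d * b + b * d * a * hbn2 * a' * d * b
      - b * d * a * n * ha * b' * a' * d * b + b * d * a * n * a * w2 * d * b
      + b * d * a * n * a * b' * a' * hbd2 * b + b * d * a * n * a * b' * a' * d * hb'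
  have e3 : d * a' * b * a * b = d * b * a := by
    linear_combination (norm := noncomm_ring) - d * a' * hab + d * ha' * b * a
  have e4 : d * a' * b * (d * a) * b = d * a' * d * (a * b * a) := by
    linear_combination (norm := noncomm_ring) d * a' * hbd * a * b - d * a' * d * hab
  have e5 : b * a * n * a' * d * b' * a' * d = b * a * n * a' * b' * (d * a' * d) := by
    linear_combination (norm := noncomm_ring) - b * a * n * a' * hbd2 * a' * d
  have e6 : b * a * b' * a' * d = a' * d * b := by
    linear_combination (norm := noncomm_ring) - w1 * a' * d + a' * b * ha * d + a' * hbd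
  have e7 : b * d * a * b' * a' * d = d * a' * d * b := by
    linear_combination (norm := noncomm_ring) hbd * a * b' * a' * d + d * e6
  linear_combination (norm := (simp only [mul_add, add_mul, smul_mul_assoc,
      mul_smul_comm, smul_add, mul_assoc]; module))
    e1 + d * a' * b * H * b + e2 + b * H * b' * a' * d + e5 + e6 + e3 + h • e4 + h • e7

end RingIdentities
-- Matrices over an algebra acting in three tensor factors.
section ThreeLegs

variable {K : Type*} [Field K] {ι : Type*} [Fintype ι] [DecidableEq ι]
  {A : Type*} [Ring A] [Algebra K A]

/-- `M ⊗ I` for a matrix `M` with entries in an algebra. -/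
def wide12 (M : Matrix (ι × ι) (ι × ι) A) : Matrix (ι × ι × ι) (ι × ι × ι) A :=
  fun x y => if x.2.2 = y.2.2 then M (x.1, x.2.1) (y.1, y.2.1) else 0

/-- `I ⊗ M` for a matrix `M` with entries in an algebra. -/
def wide23 (M : Matrix (ι × ι) (ι × ι) A) : Matrix (ι × ι × ι) (ι × ι × ι) A :=
  fun x y => if x.1 = y.1 then M x.2 y.2 else 0

theorem wide12_mul (M M' : Matrix (ι × ι) (ι × ι) A) :
    wide12 (M * M') = wide12 M * wide12 M' := by
  ext x y
  by_cases h : x.2.2 = y.2.2 <;>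
    simp [h, wide12, Matrix.mul_apply, Fintype.sum_prod_type]

theorem wide23_mul (M M' : Matrix (ι × ι) (ι × ι) A) :
    wide23 (M * M') = wide23 M * wide23 M' := by
  ext x y
  by_cases h : x.1 = y.1 <;>
    simp [h, wide23, Matrix.mul_apply, Fintype.sum_prod_type]

/-- `M ↦ M ⊗ I` as an algebra map. -/
def ext12 (K : Type*) [Field K] {ι : Type*} [Fintype ι] [DecidableEq ι]
    {A : Type*} [Ring A] [Algebra K A] :
    Matrix (ι × ι) (ι × ι) A →ₐ[K] Matrix (ι × ι × ι) (ι × ι × ι) A :=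
  AlgHom.ofLinearMap
    { toFun := wide12
      map_add' := fun M M' => by
        ext x y
        by_cases h : x.2.2 = y.2.2 <;> simp [wide12, h]
      map_smul' := fun c M => by
        ext x y
        by_cases h : x.2.2 = y.2.2 <;> simp [wide12, h] }
    (by
      ext ⟨x, y, z⟩ ⟨x', y', z'⟩
      by_cases h : z = z' <;> simp [wide12, h, Matrix.one_apply])
    wide12_mul

theorem ext12_apply (M : Matrix (ι × ι) (ι × ι) A) (x y : ι × ι × ι) :
    ext12 K M x y = if x.2.2 = y.2.2 then M (x.1, x.2.1) (y.1, y.2.1) else 0 := rfl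

/-- `M ↦ I ⊗ M` as an algebra map. -/
def ext23 (K : Type*) [Field K] {ι : Type*} [Fintype ι] [DecidableEq ι]
    {A : Type*} [Ring A] [Algebra K A] :
    Matrix (ι × ι) (ι × ι) A →ₐ[K] Matrix (ι × ι × ι) (ι × ι × ι) A :=
  AlgHom.ofLinearMap
    { toFun := wide23
      map_add' := fun M M' => by
        ext x y
        by_cases h : x.1 = y.1 <;> simp [wide23, h]
      map_smul' := fun c M => by
        ext x y
        by_cases h : x.1 = y.1 <;> simp [wide23, h] }
    (by
      ext ⟨x, y, z⟩ ⟨x', y', z'⟩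
      by_cases h : x = x' <;> simp [wide23, h, Matrix.one_apply])
    wide23_mul

theorem ext23_apply (M : Matrix (ι × ι) (ι × ι) A) (x y : ι × ι × ι) :
    ext23 K M x y = if x.1 = y.1 then M x.2 y.2 else 0 := rfl

theorem leg12_eq (M : Matrix (ι × ι) (ι × ι) K) : leg12 M = ext12 K M := rfl

theorem leg23_eq (M : Matrix (ι × ι) (ι × ι) K) : leg23 M = ext23 K M := rfl

theorem scal_eq {n : Type*} [Fintype n] [DecidableEq n] (M : Matrix n n K) :
    scal A M = (Algebra.ofId K A).mapMatrix M := rfl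

theorem scal_mul {n : Type*} [Fintype n] [DecidableEq n] (M M' : Matrix n n K) :
    scal A (M * M') = scal A M * scal A M' := by
  simp only [scal_eq, map_mul]

theorem scal_one {n : Type*} [Fintype n] [DecidableEq n] :
    scal A (1 : Matrix n n K) = 1 := by
  simp only [scal_eq, map_one]

theorem scal_sub {n : Type*} [Fintype n] [DecidableEq n] (M M' : Matrix n n K) :
    scal A (M - M') = scal A M - scal A M' := by
  simp only [scal_eq, map_sub]

theorem scal_smul_one {n : Type*} [Fintype n] [DecidableEq n] (c : K) :
    scal A (c • (1 : Matrix n n K)) = c • 1 := by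
  simp only [scal_eq, map_smul, map_one]

theorem scal_ext12 (M : Matrix (ι × ι) (ι × ι) K) :
    ext12 K (scal A M) = scal A (ext12 K M) := by
  ext x y
  simp only [ext12_apply, scal, Matrix.map_apply]
  split_ifs <;> simp

theorem scal_ext23 (M : Matrix (ι × ι) (ι × ι) K) :
    ext23 K (scal A M) = scal A (ext23 K M) := by
  ext x y
  simp only [ext23_apply, scal, Matrix.map_apply]
  split_ifs <;> simp

theorem leg1_apply (X : Matrix ι ι A) (x y : ι × ι) :
    leg1 X x y = if x.2 = y.2 then X x.1 y.1 else 0 := by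
  simp [leg1, Matrix.kroneckerMap_apply, Matrix.one_apply]

theorem ext12_leg1_apply (X : Matrix ι ι A) (x y : ι × ι × ι) :
    ext12 K (leg1 X) x y = if x.2 = y.2 then X x.1 y.1 else 0 := by
  obtain ⟨x, x', x''⟩ := x
  obtain ⟨y, y', y''⟩ := y
  simp only [ext12_apply, leg1_apply, Prod.mk.injEq]
  by_cases h1 : x'' = y'' <;> by_cases h2 : x' = y' <;> simp [h1, h2]

theorem ext23_scal_comm_leg1 (M : Matrix (ι × ι) (ι × ι) K) (X : Matrix ι ι A) :
    ext23 K (scal A M) * ext12 K (leg1 X) = ext12 K (leg1 X) * ext23 K (scal A M) := by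
  ext ⟨x, x'⟩ ⟨y, y'⟩
  have e (g : ι × ι × ι → A) : ∑ z, g z = ∑ z₂, ∑ z₁, g (z₁, z₂) :=
    Fintype.sum_prod_type_right g
  simp only [Matrix.mul_apply, e]
  simp [ext12_leg1_apply, ext23_apply, scal, Algebra.commutes]

/-- The scalar matrix with a given element of the algebra on the diagonal. -/
def diagElt (n : Type*) [DecidableEq n] (u : A) : Matrix n n A := Matrix.diagonal fun _ => u

theorem diagElt_scal {n : Type*} [Fintype n] [DecidableEq n] (u : A) (M : Matrix n n K) :
    scal A M * diagElt n u = diagElt n u * scal A M := by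
  ext x y
  simp [diagElt, scal, Algebra.commutes]

theorem ext12_diagElt (u : A) : ext12 K (diagElt (ι × ι) u) = diagElt (ι × ι × ι) u := by
  ext ⟨x, y, z⟩ ⟨x', y', z'⟩
  by_cases h : z = z' <;> simp [ext12_apply, diagElt, Matrix.diagonal_apply, h]

theorem diagElt_leg1 {u : A} {n n' : Matrix ι ι A} (h : ∀ i j, u * n' i j = n i j * u) :
    diagElt (ι × ι) u * leg1 n' = leg1 n * diagElt (ι × ι) u := by
  ext x y
  simp only [diagElt, Matrix.diagonal_mul, Matrix.mul_diagonal, leg1_apply]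
  split_ifs <;> simp [h]

end ThreeLegs

/-! ### The Hecke condition. -/

section Hecke

variable {K : Type*} [Field K] {ι : Type*} [Fintype ι] [DecidableEq ι]
  {R : Matrix (ι × ι) (ι × ι) K} {q : K}

theorem IsHeckeSymmetry.isUnit_det (hR : IsHeckeSymmetry R q) : IsUnit R.det :=
  (Matrix.isUnit_iff_isUnit_det R).1 hR.invertible

/-- The right side is a scalar, hence the same in every pair of legs: this yields the hypothesis `a
- a' = b - b'` of the ring identities. -/
theorem IsHeckeSymmetry.sub_inv (hR : IsHeckeSymmetry R q) (hq : q ≠ 0) :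
    R - R⁻¹ = (q - q⁻¹) • (1 : Matrix (ι × ι) (ι × ι) K) := by
  have h := hR.hecke
  have h1 := Matrix.nonsing_inv_mul R hR.isUnit_det
  have h2 : R⁻¹ * ((R - q • (1 : Matrix (ι × ι) (ι × ι) K)) *
    (R + q⁻¹ • (1 : Matrix (ι × ι) (ι × ι) K))) = R - (q - q⁻¹) • 1 - R⁻¹ := by
    have h3 : (R - q • (1 : Matrix (ι × ι) (ι × ι) K)) *
      (R + q⁻¹ • (1 : Matrix (ι × ι) (ι × ι) K)) = R * R - (q - q⁻¹) • R - 1 := by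
      simp only [sub_mul, mul_add, smul_mul_assoc, mul_smul_comm, mul_one, one_mul, smul_sub,
        smul_smul, inv_mul_cancel₀ hq, sub_smul, one_smul]
      abel
    rw [h3, mul_sub, mul_sub, ← mul_assoc, h1, mul_smul_comm, h1, one_mul, mul_one]
  rw [h, mul_zero] at h2
  rw [sub_sub, eq_comm, sub_eq_zero] at h2
  rw [sub_eq_iff_eq_add]
  exact h2

end Hecke

/-! ### Removing a contraction with `R` by skew-invertibility. -/

section Strip

variable {K : Type*} [Field K] {ι : Type*} [Fintype ι] [DecidableEq ι]
  {R Ψ : Matrix (ι × ι) (ι × ι) K} {V : Type*} [AddCommGroup V] [Module K V]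

theorem IsSkewInverse.sum_left (h : IsSkewInverse R Ψ) (x x' y y' : ι) :
    ∑ a, ∑ b, R (x, a) (y, b) * Ψ (b, x') (a, y') = if x = y' ∧ x' = y then 1 else 0 := by
  have := congrFun (congrFun h.left (x, x')) (y, y')
  simpa [trMid, flipOp, leg12, leg23, Matrix.mul_apply, Fintype.sum_prod_type] using this

theorem IsSkewInverse.sum_right (h : IsSkewInverse R Ψ) (x x' y y' : ι) :
    ∑ a, ∑ b, Ψ (x, a) (y, b) * R (b, x') (a, y') = if x = y' ∧ x' = y then 1 else 0 := by
  have := congrFun (congrFun h.right (x, x')) (y, y')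
  simpa [trMid, flipOp, leg12, leg23, Matrix.mul_apply, Fintype.sum_prod_type] using this

theorem sum_four_comm {M : Type*} [AddCommMonoid M] (f : ι → ι → ι → ι → M) :
    ∑ a, ∑ b, ∑ i, ∑ j, f a b i j = ∑ i, ∑ j, ∑ a, ∑ b, f a b i j := by
  have := Finset.sum_comm (s := Finset.univ) (t := Finset.univ)
    (f := fun (p r : ι × ι) => f p.1 p.2 r.1 r.2)
  simpa only [Fintype.sum_prod_type] using this

/-- Contraction with `R` is a linear map on families of vectors, and contraction with `Ψ` is a left
inverse here and a right inverse in `IsSkewInverse.sum_sum`. So statements about contracted products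
descend to the individual products. -/
theorem IsSkewInverse.eq_sum (h : IsSkewInverse R Ψ) (F : ι → ι → V) (x y : ι) :
    F y x = ∑ i, ∑ j, Ψ (j, x) (i, y) • ∑ a, ∑ b, R (a, i) (b, j) • F a b := by
  simp only [Finset.smul_sum, smul_smul]
  rw [sum_four_comm]
  have h1 : ∀ a b : ι, ∑ i, ∑ j, Ψ (j, x) (i, y) * R (a, i) (b, j) =
      if a = y ∧ x = b then 1 else 0 := fun a b => by
    rw [← h.sum_left a x b y]
    simp only [mul_comm]
  simp only [← Finset.sum_smul, h1]
  simp [ite_and, ite_smul]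

theorem IsSkewInverse.sum_sum (h : IsSkewInverse R Ψ) (G : ι → ι → V) (x y : ι) :
    ∑ a, ∑ b, R (a, x) (b, y) • ∑ i, ∑ j, Ψ (j, b) (i, a) • G i j = G x y := by
  simp only [Finset.smul_sum, smul_smul]
  rw [sum_four_comm]
  have h1 : ∀ i j : ι, ∑ a, ∑ b, R (a, x) (b, y) * Ψ (j, b) (i, a) =
      if j = y ∧ x = i then 1 else 0 := fun i j => by
    rw [← h.sum_right j x i y, Finset.sum_comm]
    simp only [mul_comm]
  simp only [← Finset.sum_smul, h1]
  simp [ite_and, ite_smul]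

theorem IsSkewInverse.exists_sum (h : IsSkewInverse R Ψ) (G : ι → ι → V) :
    ∃ F : ι → ι → V, ∀ i j, ∑ a, ∑ b, R (a, i) (b, j) • F a b = G i j :=
  ⟨fun a b => ∑ i, ∑ j, Ψ (j, b) (i, a) • G i j, h.sum_sum G⟩

theorem IsSkewInverse.mem_of_sum_mem (h : IsSkewInverse R Ψ) (J : Submodule K V)
    (F : ι → ι → V) (hF : ∀ i j, ∑ a, ∑ b, R (a, i) (b, j) • F a b ∈ J) (a b : ι) :
    F a b ∈ J := by
  rw [h.eq_sum F]
  exact Submodule.sum_mem _ fun i _ => Submodule.sum_mem _ fun j _ =>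
    Submodule.smul_mem _ _ (hF i j)

end Strip

/-! ### The commutator of `R` with a product of two derivatives. -/

section RingIdentities

variable {K S : Type*} [Field K] [Ring S] [Algebra K S]

/-- Conjugation by `b a` carries `b` to `a` by the braid relation, and `b` commutes with `n`. -/
theorem commute_shifted {a b a' b' n : S}
    (ha : a * a' = 1) (ha' : a' * a = 1) (hb : b * b' = 1) (hb' : b' * b = 1)
    (hab : a * b * a = b * a * b) (hbn : b * n = n * b) :
    a * (b * a * n * a' * b') = (b * a * n * a' * b') * a := by
  have e2 : b * a' * b' = a' * b' * a := by
    linear_combination (norm := noncomm_ring) - ha' * b * a' * b' - a' * hb' * a * b * a' * b'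
      - a' * b' * hab * a' * b' + a' * b' * a * b * ha * b' + a' * b' * a * hb
  linear_combination (norm := noncomm_ring) hab * n * a' * b' + b * a * hbn * a' * b'
    + b * a * n * e2

/-- If `a - a'` is a scalar, every `x + a x a` commutes with `a`; this is the case `x = b`. -/
theorem commute_add_conj {a b a' b' : S}
    (ha : a * a' = 1) (ha' : a' * a = 1) (hb : b * b' = 1) (hb' : b' * b = 1)
    (hl : a - a' = b - b') : a * (b + a * b * a) = (b + a * b * a) * a := by
  linear_combination (norm := noncomm_ring) ha * b * a + a * hl * b * a - a * hb' * a
    - a * b * ha' - a * b * hl * a + a * hb * a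

/-- Moving the commutator of `R` with a product of two derivatives past a generator. -/
theorem commutator_past_generator {a b a' b' d n : S} (h : K)
    (ha : a * a' = 1) (ha' : a' * a = 1) (hb : b * b' = 1) (hb' : b' * b = 1)
    (hl : a - a' = b - b') (hab : a * b * a = b * a * b)
    (hbn : b * n = n * b) (hbd : b * d = d * b)
    (H : d * a * n * a = a * n * a' * d + a + h • (d * a)) :
    (a * (d * a' * d) - d * a' * d * a) * (b * a * n * a * b) =
      (b * a * n * a' * b') * (a * (d * a' * d) - d * a' * d * a) +
      h • ((a * (d * a' * d) - d * a' * d * a) * (b + a * b * a)) := by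
  have hbd2 := comm_of_inverse hb hb' hbd
  have e := derivatives_past_generator h ha ha' hb hb' hab hbn hbd H
  -- The inhomogeneous terms drop out of the commutator: they form `x + a x a` with `x = a' d b`,
  -- which commutes with `a`.
  have e0 : d * b + a * d * b * a - a' * d * b * a - d * b * a * a = 0 := by
    linear_combination (norm := noncomm_ring) hl * d * b * a + hbd * b * a - hbd2 * b * a
      - d * hb' * a - d * b * ha' - d * b * hl * a + d * hb * a
  have e1 : a * (b * a * n * a * b) = (b * a * n * a * b) * a := by
    linear_combination (norm := noncomm_ring) hab * n * a * b + b * a * hbn * a * b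
      - b * a * n * hab
  have e3 := commute_shifted ha ha' hb hb' hab hbn
  have e4 := commute_add_conj ha ha' hb hb' hl
  generalize d * a' * d = z at *
  generalize b * a * n * a * b = l at *
  generalize b * a * n * a' * b' = k at *
  generalize b + a * b * a = w at *
  linear_combination (norm := (simp only [mul_add, add_mul, mul_sub, sub_mul, smul_mul_assoc,
      mul_smul_comm, smul_sub, mul_assoc, one_mul]; module))
    a * e - e * a - z * e1 + e3 * z + h • (z * e4) + ha * d * b + e0
end RingIdentities

/-! ### Propagating statements modulo a left ideal from `f` to `n_i^j f`. -/

section Closure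

variable {K : Type*} [Field K] {ι : Type*} [Fintype ι] [DecidableEq ι]
  {A : Type*} [Ring A] [Algebra K A] {R Ψ : Matrix (ι × ι) (ι × ι) K} {q ħ : K}

theorem wide_entry (R : Matrix (ι × ι) (ι × ι) K) (M : Matrix (ι × ι) (ι × ι) A)
    (X : Matrix ι ι A) (x y : ι × ι × ι) :
    (ext12 K M * ext23 K (scal A R) * ext12 K (scal A R) * ext12 K (leg1 X)) x y =
      ∑ b, ∑ c, R (b, x.2.2) (c, y.2.2) • ∑ a, ∑ e, R (a, c) (e, y.2.1) •
        (M (x.1, x.2.1) (a, b) * X e y.1) := by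
  obtain ⟨x1, x2, x3⟩ := x
  obtain ⟨y1, y2, y3⟩ := y
  have h1 (z1 z2 z3 : ι) : (ext12 K M * ext23 K (scal A R)) (x1, x2, x3) (z1, z2, z3) =
      ∑ b, R (b, x3) (z2, z3) • M (x1, x2) (z1, b) := by
    simp [Matrix.mul_apply, Fintype.sum_prod_type, ext12_apply, ext23_apply, scal,
      Algebra.smul_def, Algebra.commutes]
  have h2 (z1 z2 z3 : ι) : (ext12 K (scal A R) * ext12 K (leg1 X)) (z1, z2, z3) (y1, y2, y3) =
      if z3 = y3 then ∑ e, R (z1, z2) (e, y2) • X e y1 else 0 := by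
    by_cases h : z3 = y3 <;>
    simp [Matrix.mul_apply, Fintype.sum_prod_type, ext12_apply, leg1_apply, scal,
      Algebra.smul_def, h]
  rw [mul_assoc, Matrix.mul_apply]
  simp only [Fintype.sum_prod_type, h1, h2]
  simp only [mul_ite, mul_zero, Finset.sum_ite_eq', Finset.mem_univ, if_true]
  simp only [Finset.sum_mul_sum, Finset.smul_sum, smul_mul_smul_comm, smul_smul]
  rw [Finset.sum_comm, Finset.sum_comm (s := Finset.univ) (t := Finset.univ)
    (f := fun b c => ∑ a, ∑ e, (R (b, x3) (c, y3) * R (a, c) (e, y2)) •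
      (M (x1, x2) (a, b) * X e y1))]
  exact Finset.sum_congr rfl fun c _ => Finset.sum_comm

/-- The matrix `∑ U_{ej} R₂₃ R₁₂ E_{ej}` built from a family of matrices `U_{ej}`. -/
def widen (R : Matrix (ι × ι) (ι × ι) K) (U : ι → ι → Matrix (ι × ι) (ι × ι) A) :
    Matrix (ι × ι × ι) (ι × ι × ι) A :=
  fun x y => ∑ b, ∑ c, R (b, x.2.2) (c, y.2.2) • ∑ a, ∑ e, R (a, c) (e, y.2.1) •
    U e y.1 (x.1, x.2.1) (a, b)

theorem widen_mul (M : Matrix (ι × ι) (ι × ι) A) (X : Matrix ι ι A) :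
    widen R (fun e j => Matrix.of fun x y => M x y * X e j) =
      ext12 K M * ext23 K (scal A R) * ext12 K (scal A R) * ext12 K (leg1 X) := by
  ext x y
  rw [wide_entry]
  rfl

theorem widen_add (U U' : ι → ι → Matrix (ι × ι) (ι × ι) A) :
    widen R (U + U') = widen R U + widen R U' := by
  ext x y
  simp only [widen, Pi.add_apply, Matrix.add_apply, smul_add, Finset.sum_add_distrib]

theorem widen_sub (U U' : ι → ι → Matrix (ι × ι) (ι × ι) A) :
    widen R (U - U') = widen R U - widen R U' := by
  ext x y
  simp only [widen, Pi.sub_apply, Matrix.sub_apply, smul_sub, Finset.sum_sub_distrib]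

/-- Splitting along matrix units writes an arbitrary family through products in three factors, so
that identities such as `widen_conj` reduce to the braid relation. -/
theorem widen_eq_sum (U : ι → ι → Matrix (ι × ι) (ι × ι) A) :
    widen R U = ∑ e, ∑ j, ext12 K (U e j) * ext23 K (scal A R) * ext12 K (scal A R) *
      ext12 K (leg1 (Matrix.single e j 1)) := by
  have hU : U = ∑ e, ∑ j, fun e' j' => Matrix.of fun x y =>
      U e j x y * Matrix.single e j (1 : A) e' j' := by
    ext e' j' x y
    simp [Finset.sum_apply, Matrix.sum_apply, Matrix.single_apply, ite_and]
  let φ := AddMonoidHom.mk' (widen (A := A) R) widen_add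
  calc widen R U = φ (∑ e, ∑ j, fun e' j' => Matrix.of fun x y =>
        U e j x y * Matrix.single e j (1 : A) e' j') := congrArg φ hU
    _ = ∑ e, ∑ j, φ fun e' j' => Matrix.of fun x y =>
        U e j x y * Matrix.single e j (1 : A) e' j' := by
      simp only [map_sum]
    _ = _ := Finset.sum_congr rfl fun e _ => Finset.sum_congr rfl fun j _ => widen_mul _ _

theorem ext_braid (hR : IsHeckeSymmetry R q) :
    ext12 K (scal A R) * ext23 K (scal A R) * ext12 K (scal A R) =
      ext23 K (scal A R) * ext12 K (scal A R) * ext23 K (scal A R) := by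
  rw [scal_ext12, scal_ext23]
  simp only [← scal_mul]
  exact congrArg _ hR.braid

theorem widen_conj (hR : IsHeckeSymmetry R q) (U : ι → ι → Matrix (ι × ι) (ι × ι) A) :
    widen R (fun e j => scal A R * U e j * scal A R) =
      ext12 K (scal A R) * widen R U * ext23 K (scal A R) := by
  have hb := ext_braid (A := A) hR
  simp only [widen_eq_sum, Finset.mul_sum, Finset.sum_mul, map_mul]
  refine Finset.sum_congr rfl fun e _ => Finset.sum_congr rfl fun j _ => ?_
  have hc := ext23_scal_comm_leg1 R (Matrix.single e j (1 : A))
  linear_combination (norm := noncomm_ring) ext12 K (scal A R) * ext12 K (U e j) * hb *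
    ext12 K (leg1 (Matrix.single e j (1 : A))) +
    ext12 K (scal A R) * ext12 K (U e j) * ext23 K (scal A R) * ext12 K (scal A R) * hc

/-- The contractions with `R₂₃` and `R₁₂` are stripped off one after the other; `widen_surjective`
solves the same two contractions for arbitrary right sides. -/
theorem mem_of_widen_mem (hΨ : IsSkewInverse R Ψ) (J : Submodule K A)
    (U : ι → ι → Matrix (ι × ι) (ι × ι) A) (h : ∀ x y, widen R U x y ∈ J) (e j : ι)
    (x y : ι × ι) : U e j x y ∈ J := by
  have h1 (x : ι × ι) (j y2 b c : ι) :
      ∑ a, ∑ e, R (a, c) (e, y2) • U e j x (a, b) ∈ J :=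
    hΨ.mem_of_sum_mem J (fun b c => ∑ a, ∑ e, R (a, c) (e, y2) • U e j x (a, b))
      (fun x3 y3 => h (x.1, x.2, x3) (j, y2, y3)) b c
  exact hΨ.mem_of_sum_mem J (fun a e => U e j x (a, y.2))
    (fun c y2 => h1 x j y2 y.2 c) y.1 e

theorem widen_surjective (hΨ : IsSkewInverse R Ψ) (T : Matrix (ι × ι × ι) (ι × ι × ι) A) :
    ∃ U, widen R U = T := by
  have h1 (x1 x2 y1 y2 : ι) := hΨ.exists_sum fun x3 y3 => T (x1, x2, x3) (y1, y2, y3)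
  choose G hG using h1
  have h2 (x1 x2 y1 b : ι) := hΨ.exists_sum fun c y2 => G x1 x2 y1 y2 b c
  choose F hF using h2
  refine ⟨fun e j x y => F x.1 x.2 j y.2 y.1 e, ?_⟩
  ext ⟨x1, x2, x3⟩ ⟨y1, y2, y3⟩
  simp only [widen, hF, hG]


/-- The entries of a matrix lie in a left ideal. -/
def EntriesIn {n : Type*} (J : Submodule A A) (M : Matrix n n A) : Prop := ∀ x y, M x y ∈ J

section EntriesIn

variable {n : Type*} [Fintype n] [DecidableEq n] {J : Submodule A A} {M M' : Matrix n n A}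

theorem EntriesIn.add (h : EntriesIn J M) (h' : EntriesIn J M') : EntriesIn J (M + M') :=
  fun x y => J.add_mem (h x y) (h' x y)

theorem EntriesIn.mul_left (h : EntriesIn J M) (X : Matrix n n A) : EntriesIn J (X * M) :=
  fun x y => by
    rw [Matrix.mul_apply]
    exact J.sum_mem fun z _ => J.smul_mem (X x z) (h z y)

theorem EntriesIn.mul_scal (h : EntriesIn J M) (X : Matrix n n K) :
    EntriesIn J (M * scal A X) :=
  fun x y => by
    rw [Matrix.mul_apply]
    refine J.sum_mem fun z _ => ?_
    rw [scal, Matrix.map_apply, ← Algebra.commutes]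
    exact J.smul_mem (algebraMap K A (X z y)) (h x z)

theorem EntriesIn.smul (h : EntriesIn J M) (c : K) : EntriesIn J (c • M) :=
  fun x y => by
    rw [Matrix.smul_apply, Algebra.smul_def]
    exact J.smul_mem _ (h x y)

theorem EntriesIn.ext12 {M : Matrix (ι × ι) (ι × ι) A} (h : EntriesIn J M) :
    EntriesIn J (ext12 K M) := fun x y => by
  rw [ext12_apply]
  split_ifs
  exacts [h _ _, J.zero_mem]

theorem EntriesIn.mul_ext12 {M : Matrix (ι × ι × ι) (ι × ι × ι) A} (h : EntriesIn J M)
    (X : Matrix (ι × ι) (ι × ι) K) : EntriesIn J (M * BraidedDeRham.ext12 K (scal A X)) := by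
  rw [scal_ext12]
  exact h.mul_scal _

theorem EntriesIn.mul_ext23 {M : Matrix (ι × ι × ι) (ι × ι × ι) A} (h : EntriesIn J M)
    (X : Matrix (ι × ι) (ι × ι) K) : EntriesIn J (M * ext23 K (scal A X)) := by
  rw [scal_ext23]
  exact h.mul_scal _

end EntriesIn

theorem mul_diagElt_apply {n : Type*} [Fintype n] [DecidableEq n] (M : Matrix n n A) (f : A)
    (x y : n) : (M * diagElt n f) x y = M x y * f := by
  simp [diagElt]

theorem leg1_mul_diagElt (X : Matrix ι ι A) (f : A) :
    leg1 (Matrix.of fun i j => X i j * f) = leg1 X * diagElt _ f := by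
  ext x y
  rw [mul_diagElt_apply, leg1_apply, leg1_apply]
  split_ifs <;> simp

theorem widen_mul_diagElt (M : Matrix (ι × ι) (ι × ι) A) (X : Matrix ι ι A) (f : A) :
    widen R (fun e j => M * diagElt _ (X e j * f)) =
      ext12 K M * ext23 K (scal A R) * ext12 K (scal A R) * ext12 K (leg1 X) *
        ext12 K (diagElt _ f) := by
  have h := widen_mul (R := R) M (Matrix.of fun i j => X i j * f)
  rw [leg1_mul_diagElt, map_mul, ← mul_assoc] at h
  rw [← h]
  congr 1
  ext e j x y
  rw [mul_diagElt_apply]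
  rfl

theorem ext12_diagElt_comm12 (f : A) (X : Matrix (ι × ι) (ι × ι) K) :
    ext12 K (scal A X) * ext12 K (diagElt _ f) = ext12 K (diagElt _ f) * ext12 K (scal A X) := by
  rw [← map_mul, ← map_mul, diagElt_scal]

theorem ext12_diagElt_comm23 (f : A) (X : Matrix (ι × ι) (ι × ι) K) :
    ext23 K (scal A X) * ext12 K (diagElt _ f) = ext12 K (diagElt _ f) * ext23 K (scal A X) := by
  rw [ext12_diagElt, scal_ext23, diagElt_scal]

theorem ext_mul_inv (hR : IsHeckeSymmetry R q) :
    ext12 K (scal A R) * ext12 K (scal A R⁻¹) = 1 ∧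
    ext12 K (scal A R⁻¹) * ext12 K (scal A R) = 1 ∧
    ext23 K (scal A R) * ext23 K (scal A R⁻¹) = 1 ∧
    ext23 K (scal A R⁻¹) * ext23 K (scal A R) = 1 := by
  simp only [← map_mul, ← scal_mul, Matrix.mul_nonsing_inv R hR.isUnit_det,
    Matrix.nonsing_inv_mul R hR.isUnit_det, scal_one, map_one, and_self]

theorem ext_sub_inv (hq : q ≠ 0) (hR : IsHeckeSymmetry R q) :
    ext12 K (scal A R) - ext12 K (scal A R⁻¹) = ext23 K (scal A R) - ext23 K (scal A R⁻¹) := by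
  simp only [← map_sub, ← scal_sub, hR.sub_inv hq, scal_smul_one, map_smul, map_one]

theorem perm_eq {N D : Matrix ι ι A} (h : permMatrix R ħ N D = 0) :
    leg1 D * scal A R * leg1 N * scal A R =
      scal A R * leg1 N * scal A R⁻¹ * leg1 D + scal A R + ħ • (leg1 D * scal A R) := by
  rw [permMatrix, sub_sub, sub_sub, sub_eq_zero] at h
  rw [h, add_assoc]

/-- The commutator of `R` with `D₁ R⁻¹ D₁`. -/
noncomputable def derComm (R : Matrix (ι × ι) (ι × ι) K) (D : Matrix ι ι A) :
    Matrix (ι × ι) (ι × ι) A :=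
  scal A R * (leg1 D * scal A R⁻¹ * leg1 D) - leg1 D * scal A R⁻¹ * leg1 D * scal A R

/-- By `commutator_past_generator` the commutator passes a dressed generator with no inhomogeneous
term, so every term ends in entries of the commutator times `f`, up to scalar matrices. -/
theorem derComm_mul_mem (hq : q ≠ 0) (hR : IsHeckeSymmetry R q) (hΨ : IsSkewInverse R Ψ)
    {N D : Matrix ι ι A} (h : permMatrix R ħ N D = 0) (J : Submodule A A) (f : A)
    (hf : EntriesIn J (derComm R D * diagElt _ f)) (i j : ι) :
    EntriesIn J (derComm R D * diagElt _ (N i j * f)) := by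
  obtain ⟨ha, ha', hb, hb'⟩ := ext_mul_inv (A := A) hR
  have H := congrArg (ext12 K) (perm_eq h)
  simp only [map_add, map_mul, map_smul] at H
  have key := commutator_past_generator ħ ha ha' hb hb' (ext_sub_inv hq hR) (ext_braid hR)
    (ext23_scal_comm_leg1 R N) (ext23_scal_comm_leg1 R D) H
  have hQ : ext12 K (derComm R D) =
      ext12 K (scal A R) * (ext12 K (leg1 D) * ext12 K (scal A R⁻¹) * ext12 K (leg1 D)) -
      ext12 K (leg1 D) * ext12 K (scal A R⁻¹) * ext12 K (leg1 D) * ext12 K (scal A R) := by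
    simp only [derComm, map_sub, map_mul]
  rw [← hQ] at key
  have hT := widen_mul_diagElt (R := R) (derComm R D) N f
  have f1 := ext12_diagElt_comm12 f R
  have f2 := ext12_diagElt_comm23 f R
  have f3 := ext12_diagElt_comm12 f R⁻¹
  have f4 := ext12_diagElt_comm23 f R⁻¹
  have hf1 := hf.ext12 (K := K)
  rw [map_mul] at hf1
  generalize ext12 K (diagElt (ι × ι) f) = F at *
  generalize hQ' : ext12 K (derComm R D) = Q at *
  -- `key` needs the factors `R₁₂ R₂₃` behind `N₁`; they are inserted together with their inverses,
  -- which commute with the diagonal matrix `F`.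
  have e : Q * ext23 K (scal A R) * ext12 K (scal A R) * ext12 K (leg1 N) * F =
      (ext23 K (scal A R) * ext12 K (scal A R) * ext12 K (leg1 N) * ext12 K (scal A R⁻¹) *
        ext23 K (scal A R⁻¹) * (Q * F) +
      ħ • (Q * F * ext23 K (scal A R) + Q * F * ext12 K (scal A R) * ext23 K (scal A R) *
        ext12 K (scal A R))) * ext23 K (scal A R⁻¹) * ext12 K (scal A R⁻¹) := by
    generalize ext12 K (scal A R) = a at *
    generalize ext12 K (scal A R⁻¹) = a' at *
    generalize ext23 K (scal A R) = b at *
    generalize ext23 K (scal A R⁻¹) = b' at *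
    generalize ext12 K (leg1 N) = n at *
    have e1 : Q * b * a * n * F = Q * (b * a * n * a * b) * F * b' * a' := by
      linear_combination (norm := noncomm_ring) - Q * b * a * n * F * ha
        - Q * b * a * n * F * a * hb * a' - Q * b * a * n * f1 * b * b' * a'
        - Q * b * a * n * a * f2 * b' * a'
    rw [e1, key]
    have e2 : Q * (b + a * b * a) * F = Q * F * b + Q * F * a * b * a := by
      linear_combination (norm := noncomm_ring) Q * f2 + Q * a * b * f1 + Q * a * f2 * a
        + Q * f1 * b * a
    rw [add_mul _ _ F, smul_mul_assoc, e2]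
    simp only [mul_assoc]
  have hE : EntriesIn J (Q * ext23 K (scal A R) * ext12 K (scal A R) * ext12 K (leg1 N) * F) := by
    rw [e]
    refine EntriesIn.mul_ext12 (EntriesIn.mul_ext23 (EntriesIn.add (hf1.mul_left _)
      (EntriesIn.smul (EntriesIn.add (hf1.mul_ext23 _) ?_) _)) _) _
    exact ((hf1.mul_ext12 _).mul_ext23 _).mul_ext12 _
  rw [← hT] at hE
  exact fun x y => mem_of_widen_mem hΨ (J.restrictScalars K) _ hE i j x y

theorem derProd_mul_mem (hq : q ≠ 0) (hR : IsHeckeSymmetry R q) (hΨ : IsSkewInverse R Ψ)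
    {N D : Matrix ι ι A} (h : permMatrix R ħ N D = 0) (J : Submodule A A) (f : A)
    (hf : ∃ X, EntriesIn J (leg1 D * scal A R⁻¹ * leg1 D * diagElt _ f -
      (X + scal A R * X * scal A R))) (i j : ι) :
    ∃ X, EntriesIn J (leg1 D * scal A R⁻¹ * leg1 D * diagElt _ (N i j * f) -
      (X + scal A R * X * scal A R)) := by
  obtain ⟨X, hX⟩ := hf
  obtain ⟨ha, ha', hb, hb'⟩ := ext_mul_inv (A := A) hR
  have hab := ext_braid (A := A) hR
  have hl := ext_sub_inv (A := A) hq hR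
  have H := congrArg (ext12 K) (perm_eq h)
  simp only [map_add, map_mul, map_smul] at H
  have hbn := ext23_scal_comm_leg1 R N
  have hbd := ext23_scal_comm_leg1 R D
  have key := derivatives_past_generator ħ ha ha' hb hb' hab hbn hbd H
  have hT := widen_mul_diagElt (R := R) (leg1 D * scal A R⁻¹ * leg1 D) N f
  have f1 := ext12_diagElt_comm12 f R
  have f2 := ext12_diagElt_comm23 f R
  have hf1 := hX.ext12 (K := K)
  simp only [map_sub, map_add, map_mul] at hf1
  rw [map_mul, map_mul] at hT
  -- The new `X` is prescribed in widened form: the old `X` carried past the generator, half of the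
  -- inhomogeneous terms, and the `ħ` correction. The other half comes from `R U R`: by `widen_conj`
  -- it is a conjugation in three factors, and the shifted generator and `R₂₃ + R₁₂ R₂₃ R₁₂` commute
  -- with `R₁₂`.
  obtain ⟨U, hU⟩ := widen_surjective hΨ
    ((ext23 K (scal A R) * ext12 K (scal A R) * ext12 K (leg1 N) * ext12 K (scal A R⁻¹) *
        ext23 K (scal A R⁻¹) * ext12 K X +
      ext12 K (scal A R⁻¹) * ext12 K (leg1 D) * ext23 K (scal A R) * ext12 K (diagElt _ f) +
      ħ • (ext12 K X * (ext23 K (scal A R) + ext12 K (scal A R) * ext23 K (scal A R) *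
        ext12 K (scal A R)))) * ext23 K (scal A R⁻¹) * ext12 K (scal A R⁻¹))
  have hU' := widen_conj hR U
  rw [hU] at hU'
  refine ⟨U i j, ?_⟩
  have hE : EntriesIn J (widen R ((fun e j => leg1 D * scal A R⁻¹ * leg1 D *
      diagElt _ (N e j * f)) - (U + fun e j => scal A R * U e j * scal A R))) := by
    rw [widen_sub, widen_add, hT, hU, hU']
    have e : ext12 K (leg1 D) * ext12 K (scal A R⁻¹) * ext12 K (leg1 D) * ext23 K (scal A R) *
        ext12 K (scal A R) * ext12 K (leg1 N) * ext12 K (diagElt _ f) -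
        ((ext23 K (scal A R) * ext12 K (scal A R) * ext12 K (leg1 N) * ext12 K (scal A R⁻¹) *
          ext23 K (scal A R⁻¹) * ext12 K X +
        ext12 K (scal A R⁻¹) * ext12 K (leg1 D) * ext23 K (scal A R) * ext12 K (diagElt _ f) +
        ħ • (ext12 K X * (ext23 K (scal A R) + ext12 K (scal A R) * ext23 K (scal A R) *
          ext12 K (scal A R)))) * ext23 K (scal A R⁻¹) * ext12 K (scal A R⁻¹) +
        ext12 K (scal A R) * ((ext23 K (scal A R) * ext12 K (scal A R) * ext12 K (leg1 N) *
          ext12 K (scal A R⁻¹) * ext23 K (scal A R⁻¹) * ext12 K X +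
        ext12 K (scal A R⁻¹) * ext12 K (leg1 D) * ext23 K (scal A R) * ext12 K (diagElt _ f) +
        ħ • (ext12 K X * (ext23 K (scal A R) + ext12 K (scal A R) * ext23 K (scal A R) *
          ext12 K (scal A R)))) * ext23 K (scal A R⁻¹) * ext12 K (scal A R⁻¹)) *
          ext23 K (scal A R)) =
        (ext23 K (scal A R) * ext12 K (scal A R) * ext12 K (leg1 N) *
          ext12 K (scal A R⁻¹) * ext23 K (scal A R⁻¹) *
          (ext12 K (leg1 D) * ext12 K (scal A R⁻¹) * ext12 K (leg1 D) * ext12 K (diagElt _ f) -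
            (ext12 K X + ext12 K (scal A R) * ext12 K X * ext12 K (scal A R))) +
        ħ • ((ext12 K (leg1 D) * ext12 K (scal A R⁻¹) * ext12 K (leg1 D) *
          ext12 K (diagElt _ f) -
            (ext12 K X + ext12 K (scal A R) * ext12 K X * ext12 K (scal A R))) *
            ext23 K (scal A R) +
          (ext12 K (leg1 D) * ext12 K (scal A R⁻¹) * ext12 K (leg1 D) *
          ext12 K (diagElt _ f) -
            (ext12 K X + ext12 K (scal A R) * ext12 K X * ext12 K (scal A R))) *
            ext12 K (scal A R) * ext23 K (scal A R) * ext12 K (scal A R))) *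
          ext23 K (scal A R⁻¹) * ext12 K (scal A R⁻¹) := by
      generalize ext12 K (diagElt (ι × ι) f) = F at *
      generalize ext12 K X = x at *
      generalize ext12 K (scal A R) = a at *
      generalize ext12 K (scal A R⁻¹) = a' at *
      generalize ext23 K (scal A R) = b at *
      generalize ext23 K (scal A R⁻¹) = b' at *
      generalize ext12 K (leg1 N) = n at *
      generalize ext12 K (leg1 D) = d at *
      have g1 : b' * a' * b = a * b' * a' := by
        linear_combination (norm := noncomm_ring) -b' * a' * b * ha - b' * a' * b * a * hb * a'
          - b' * a' * hab * b' * a' + b' * ha' * b * a * b' * a' + hb' * a * b' * a'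
      have g2 := commute_shifted ha ha' hb hb' hab hbn
      have g3 := commute_add_conj ha ha' hb hb' hl
      have e1 : d * a' * d * b * a * n * F = d * a' * d * (b * a * n * a * b) * F * b' * a' := by
        linear_combination (norm := noncomm_ring) - d * a' * d * b * a * n * F * ha
          - d * a' * d * b * a * n * F * a * hb * a' - d * a' * d * b * a * n * f1 * b * b' * a'
          - d * a' * d * b * a * n * a * f2 * b' * a'
      have e2 : d * a' * d * (b + a * b * a) * F =
          d * a' * d * F * b + d * a' * d * F * a * b * a := by
        linear_combination (norm := noncomm_ring) d * a' * d * f2 + d * a' * d * a * b * f1 +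
          d * a' * d * a * f2 * a + d * a' * d * f1 * b * a
      rw [e1, key]
      generalize d * a' * d = z at *
      generalize b * a * n * a' * b' = k at *
      linear_combination (norm := (simp only [mul_add, add_mul, mul_sub, sub_mul,
          smul_mul_assoc, mul_smul_comm, smul_add, smul_sub, mul_assoc, one_mul]; module))
        ħ • (e2 * b' * a') + d * b * f1 * b' * a'
        - a * (k * x + a' * d * b * F + ħ • (x * (b + a * b * a))) * g1
        - g2 * x * a * b' * a' - ha * d * b * F * a * b' * a'
        + ħ • (a * x * g3 * b' * a')
    rw [e]
    refine EntriesIn.mul_ext12 (EntriesIn.mul_ext23 (EntriesIn.add (hf1.mul_left _)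
      (EntriesIn.smul (EntriesIn.add (hf1.mul_ext23 _) ?_) _)) _) _
    exact ((hf1.mul_ext12 _).mul_ext23 _).mul_ext12 _
  exact fun x y => mem_of_widen_mem hΨ (J.restrictScalars K) _ hE i j x y

end Closure
-- The identity `C B = ν I`, and `Ψ̂` as a skew-inverse of `R⁻¹`.
section SkewInverse

variable {K : Type*} [Field K] {ι : Type*} [Fintype ι] [DecidableEq ι]
  {R Ψ : Matrix (ι × ι) (ι × ι) K} {q : K}

theorem sum_three_rev {M : Type*} [AddCommMonoid M] (f : ι → ι → ι → M) :
    ∑ a, ∑ b, ∑ c, f a b c = ∑ c, ∑ b, ∑ a, f a b c := by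
  rw [Finset.sum_comm]
  calc _ = ∑ b, ∑ c, ∑ a, f a b c := Finset.sum_congr rfl fun b _ => Finset.sum_comm
    _ = _ := Finset.sum_comm

theorem trace_opB (Ψ : Matrix (ι × ι) (ι × ι) K) : (opB Ψ).trace = (opC Ψ).trace := by
  simp only [Matrix.trace, Matrix.diag, opB, opC]
  exact Finset.sum_comm

theorem IsHeckeSymmetry.inv_apply (hR : IsHeckeSymmetry R q) (hq : q ≠ 0) (x y : ι × ι) :
    R⁻¹ x y = R x y - (q - q⁻¹) * (1 : Matrix (ι × ι) (ι × ι) K) x y := by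
  have h := congrFun (congrFun (hR.sub_inv hq) x) y
  rw [Matrix.sub_apply, Matrix.smul_apply, smul_eq_mul] at h
  rw [← h, sub_sub_cancel]

/-- This is `Tr₂ R₁₂ C₂ = I`, obtained by tracing the skew-inverse relation once more;
`IsSkewInverse.sum_opB` is `Tr₁ B₁ R₁₂ = I`. -/
theorem IsSkewInverse.sum_opC (h : IsSkewInverse R Ψ) (x y : ι) :
    ∑ a, ∑ b, R (x, a) (y, b) * opC Ψ b a = if x = y then 1 else 0 := by
  have h1 (z : ι) := h.sum_left x z y z
  have h2 := Finset.sum_congr (s₁ := Finset.univ) rfl fun z (_ : z ∈ Finset.univ) => h1 z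
  rw [Finset.sum_comm] at h2
  simp only [opC, Finset.mul_sum]
  calc _ = ∑ a, ∑ z, ∑ b, R (x, a) (y, b) * Ψ (b, z) (a, z) :=
        Finset.sum_congr rfl fun a _ => Finset.sum_comm
    _ = _ := h2
    _ = _ := by simp [ite_and]

theorem IsSkewInverse.sum_opB (h : IsSkewInverse R Ψ) (x y : ι) :
    ∑ a, ∑ b, opB Ψ a b * R (b, x) (a, y) = if x = y then 1 else 0 := by
  have h1 (z : ι) := h.sum_right z x z y
  have h2 := Finset.sum_congr (s₁ := Finset.univ) rfl fun z (_ : z ∈ Finset.univ) => h1 z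
  rw [Finset.sum_comm] at h2
  simp only [opB, Finset.sum_mul]
  calc _ = ∑ a, ∑ z, ∑ b, Ψ (z, a) (z, b) * R (b, x) (a, y) :=
        Finset.sum_congr rfl fun a _ => Finset.sum_comm
    _ = _ := h2
    _ = _ := by simp [ite_and, eq_comm]

theorem IsSkewInverse.sum_inv_opC (h : IsSkewInverse R Ψ) (hR : IsHeckeSymmetry R q)
    (hq : q ≠ 0) (x y : ι) :
    ∑ a, ∑ b, R⁻¹ (x, a) (y, b) * opC Ψ b a = if x = y then nu Ψ q else 0 := by
  simp only [hR.inv_apply hq, sub_mul, Finset.sum_sub_distrib, h.sum_opC, nu, trace_opB]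
  by_cases hxy : x = y <;>
    simp [hxy, Matrix.one_apply, Matrix.trace, Finset.mul_sum]

/-- Multiply `R₁₂ R₂₃ R₁₂⁻¹ = R₂₃⁻¹ R₁₂ R₂₃` by `B₁` and trace over the first factor. The right side
collapses to `I` because `Tr₁ B₁ R₁₂ = I`; on the left the middle `R₂₃` is stripped off with `Ψ`,
whose trace is `B`. -/
theorem IsSkewInverse.opB_conj (h : IsSkewInverse R Ψ) (hR : IsHeckeSymmetry R q)
    (j j' l l' : ι) :
    ∑ x, ∑ p, R (x, j) (p, l) * ∑ y, opB Ψ y x * R⁻¹ (p, l') (y, j') =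
      if j = j' then opB Ψ l' l else 0 := by
  have hM : leg12 R * leg23 R * leg12 R⁻¹ = leg23 R⁻¹ * leg12 R * leg23 R := by
    have h1 := Matrix.mul_nonsing_inv R hR.isUnit_det
    have h2 := Matrix.nonsing_inv_mul R hR.isUnit_det
    have e1 : leg12 R * leg12 R⁻¹ = 1 := by rw [leg12_eq, leg12_eq, ← map_mul, h1, map_one]
    have e2 : leg23 R⁻¹ * leg23 R = 1 := by rw [leg23_eq, leg23_eq, ← map_mul, h2, map_one]
    linear_combination (norm := noncomm_ring) - leg23 R⁻¹ * hR.braid * leg12 R⁻¹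
      - e2 * leg12 R * leg23 R * leg12 R⁻¹ + leg23 R⁻¹ * leg12 R * leg23 R * e1
  have hL (x i y k : ι) : (leg12 R * leg23 R * leg12 R⁻¹) (x, j, i) (y, j', k) =
      ∑ p, ∑ b, ∑ a, R (x, j) (p, a) * R (a, i) (b, k) * R⁻¹ (p, b) (y, j') := by
    simp [Matrix.mul_apply, Fintype.sum_prod_type, leg12, leg23, Finset.sum_mul]
  have hr (x i y k : ι) : (leg23 R⁻¹ * leg12 R * leg23 R) (x, j, i) (y, j', k) =
      ∑ w, ∑ v, ∑ u, R⁻¹ (j, i) (u, v) * R (x, u) (y, w) * R (w, v) (j', k) := by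
    simp [Matrix.mul_apply, Fintype.sum_prod_type, leg12, leg23, Finset.sum_mul]
  have hS (i k : ι) : ∑ u, ∑ v, R⁻¹ (j, i) (u, v) * R (u, v) (j', k) =
      if j = j' ∧ i = k then 1 else 0 := by
    have := congrFun (congrFun (Matrix.nonsing_inv_mul R hR.isUnit_det) (j, i)) (j', k)
    simpa [Matrix.mul_apply, Fintype.sum_prod_type, Matrix.one_apply] using this
  have h1 (i k : ι) : ∑ a, ∑ b, R (a, i) (b, k) *
      ∑ x, ∑ p, R (x, j) (p, a) * ∑ y, opB Ψ y x * R⁻¹ (p, b) (y, j') =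
      if j = j' ∧ i = k then 1 else 0 := by
    calc _ = ∑ x, ∑ y, opB Ψ y x * (leg12 R * leg23 R * leg12 R⁻¹) (x, j, i) (y, j', k) := by
          simp only [hL, Finset.mul_sum]
          rw [sum_four_comm]
          refine Finset.sum_congr rfl fun x _ => ?_
          refine Eq.trans ?_ Finset.sum_comm
          refine Finset.sum_congr rfl fun p _ => ?_
          rw [sum_three_rev]
          refine Finset.sum_congr rfl fun y _ => Finset.sum_congr rfl fun b _ =>
            Finset.sum_congr rfl fun a _ => ?_
          ring
      _ = ∑ w, ∑ v, ∑ u, R⁻¹ (j, i) (u, v) * R (w, v) (j', k) *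
            ∑ y, ∑ x, opB Ψ y x * R (x, u) (y, w) := by
          simp only [hM, hr, Finset.mul_sum]
          rw [sum_four_comm]
          refine Finset.sum_congr rfl fun w _ => Finset.sum_congr rfl fun v _ => ?_
          rw [sum_three_rev]
          refine Finset.sum_congr rfl fun u _ => Finset.sum_congr rfl fun y _ =>
            Finset.sum_congr rfl fun x _ => ?_
          ring
      _ = _ := by
          simp only [h.sum_opB, mul_ite, mul_one, mul_zero]
          simp only [Finset.sum_ite_eq', Finset.mem_univ, if_true]
          exact hS i k
  rw [h.eq_sum (fun l l' => ∑ x, ∑ p, R (x, j) (p, l) * ∑ y, opB Ψ y x * R⁻¹ (p, l') (y, j'))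
    l' l]
  simp only [smul_eq_mul, h1]
  by_cases hj : j = j' <;> simp [hj, opB]

theorem IsSkewInverse.opB_mul_inv (h : IsSkewInverse R Ψ) (hR : IsHeckeSymmetry R q)
    (x y l y' : ι) :
    ∑ i, opB Ψ i y * R⁻¹ (x, l) (i, y') = ∑ j, opB Ψ l j * Ψ (j, x) (y', y) := by
  have h1 := h.eq_sum (fun x p => ∑ y, opB Ψ y x * R⁻¹ (p, l) (y, y')) x y
  simp only [smul_eq_mul, h.opB_conj hR] at h1
  rw [h1, Finset.sum_comm]
  simp [mul_comm]

theorem IsSkewInverse.opC_mul_opB (h : IsSkewInverse R Ψ) (hR : IsHeckeSymmetry R q)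
    (hq : q ≠ 0) : opC Ψ * opB Ψ = nu Ψ q • (1 : Matrix ι ι K) := by
  have h1 (x y : ι) : ∑ j, ∑ y', (opC Ψ * opB Ψ) y' j * Ψ (j, x) (y', y) =
      nu Ψ q * opB Ψ x y := by
    calc _ = ∑ y', ∑ l, opC Ψ y' l * ∑ j, opB Ψ l j * Ψ (j, x) (y', y) := by
          rw [Finset.sum_comm]
          refine Finset.sum_congr rfl fun y' _ => ?_
          simp only [Matrix.mul_apply, Finset.sum_mul, Finset.mul_sum, mul_assoc]
          exact Finset.sum_comm
      _ = ∑ i, opB Ψ i y * ∑ l, ∑ y', R⁻¹ (x, l) (i, y') * opC Ψ y' l := by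
          simp only [← h.opB_mul_inv hR, Finset.mul_sum]
          rw [sum_three_rev]
          refine Finset.sum_congr rfl fun i _ => Finset.sum_congr rfl fun l _ =>
            Finset.sum_congr rfl fun y' _ => ?_
          ring
      _ = _ := by
          simp only [h.sum_inv_opC hR hq]
          simp [mul_comm]
  -- Contracting a matrix with `Ψ` is injective since `R` undoes it, and by `h1` the matrices `C B`
  -- and `ν I` have the same contraction `ν B`.
  have h2 (s t : ι) : ∑ x, ∑ y, (∑ j, ∑ y', (opC Ψ * opB Ψ - nu Ψ q • (1 : Matrix ι ι K)) y' j *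
      Ψ (j, x) (y', y)) * R (y, s) (x, t) = (opC Ψ * opB Ψ - nu Ψ q • (1 : Matrix ι ι K)) s t := by
    generalize opC Ψ * opB Ψ - nu Ψ q • (1 : Matrix ι ι K) = E
    simp only [Finset.sum_mul]
    rw [sum_four_comm]
    simp only [mul_assoc, ← Finset.mul_sum, h.sum_right]
    simp [ite_and]
  have h3 (x y : ι) : ∑ j, ∑ y', (opC Ψ * opB Ψ - nu Ψ q • (1 : Matrix ι ι K)) y' j *
      Ψ (j, x) (y', y) = 0 := by
    simp only [Matrix.sub_apply, sub_mul, Finset.sum_sub_distrib, h1]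
    simp [Matrix.one_apply, opB, Finset.mul_sum]
  rw [← sub_eq_zero]
  ext s t
  rw [← h2]
  simp only [h3, zero_mul, Finset.sum_const_zero, Matrix.zero_apply]

/-- If `ν = 0`, then `C B = 0` forces `C = 0`, so `Tr B = Tr C = 0` and `ν = 1`. -/
theorem nu_ne_zero (h : IsSkewInverse R Ψ) (hR : IsHeckeSymmetry R q) (hq : q ≠ 0)
    (hB : IsUnit (opB Ψ)) : nu Ψ q ≠ 0 := by
  intro h0
  have h1 := h.opC_mul_opB hR hq
  rw [h0, zero_smul] at h1
  have hC : opC Ψ = 0 := hB.mul_left_eq_zero.1 h1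
  have hB0 : (opB Ψ).trace = 0 := by
    rw [trace_opB, hC, Matrix.trace_zero]
  rw [nu, hB0, mul_zero, sub_zero] at h0
  exact one_ne_zero h0

/-- Write `R⁻¹ = R - (q - q⁻¹) I`. The flipped `Ψ` inverts `R` but leaves the defect `(q - q⁻¹) B`
from the identity term; the correction `(q - q⁻¹) ν⁻¹ B₁ C₂` cancels it because `Tr₂ R⁻¹₁₂ C₂ = ν
I`. -/
theorem hatPsi_sum (h : IsSkewInverse R Ψ) (hR : IsHeckeSymmetry R q) (hq : q ≠ 0)
    (hB : IsUnit (opB Ψ)) (a b c d : ι) :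
    ∑ i, ∑ j, hatPsi Ψ q (a, i) (b, j) * R⁻¹ (c, j) (d, i) =
      if a = d ∧ c = b then 1 else 0 := by
  have hν := nu_ne_zero h hR hq hB
  have e1 : ∑ i, ∑ j, Ψ (i, a) (j, b) * R (c, j) (d, i) = if c = b ∧ a = d then 1 else 0 := by
    rw [← h.sum_left c a d b, Finset.sum_comm]
    simp only [mul_comm]
  have e2 : ∑ i, ∑ j, Ψ (i, a) (j, b) * (1 : Matrix (ι × ι) (ι × ι) K) (c, j) (d, i) =
      if c = d then opB Ψ a b else 0 := by
    by_cases hcd : c = d <;> simp [hcd, Matrix.one_apply, opB]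
  have e3 : ∑ i, ∑ j, (opB Ψ ⊗ₖ opC Ψ) (a, i) (b, j) * R⁻¹ (c, j) (d, i) =
      if c = d then opB Ψ a b * nu Ψ q else 0 := by
    have := h.sum_inv_opC hR hq c d
    rw [Finset.sum_comm] at this
    simp only [Matrix.kroneckerMap_apply, mul_assoc, ← Finset.mul_sum]
    simp only [mul_comm (opC Ψ _ _), this]
    simp
  simp only [hatPsi, Matrix.add_apply, Matrix.smul_apply, Matrix.submatrix_apply, Prod.swap,
    add_mul, Finset.sum_add_distrib, smul_eq_mul, mul_assoc, ← Finset.mul_sum, e3]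
  simp only [hR.inv_apply hq, mul_sub, Finset.sum_sub_distrib, e1, mul_left_comm _ (q - q⁻¹),
    ← Finset.mul_sum, e2]
  by_cases hcd : c = d
  · simp [hcd, and_comm, mul_left_comm _ (opB Ψ a b), hν]
  · simp [hcd, and_comm]

end SkewInverse
-- Entry formulas.
section Entries

variable {K : Type*} [Field K] {ι : Type*} [Fintype ι] [DecidableEq ι]
  {A : Type*} [Ring A] [Algebra K A] {A' : Type*} [Ring A'] [Algebra K A']

theorem scal_mul_apply {n : Type*} [Fintype n] (R : Matrix n n K) (M : Matrix n n A) (x y : n) :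
    (scal A R * M) x y = ∑ z, R x z • M z y := by
  simp [Matrix.mul_apply, scal, Algebra.smul_def]

theorem mul_scal_apply {n : Type*} [Fintype n] (R : Matrix n n K) (M : Matrix n n A) (x y : n) :
    (M * scal A R) x y = ∑ z, R z y • M x z := by
  simp [Matrix.mul_apply, scal, Algebra.smul_def, Algebra.commutes]

theorem leg1_mul_apply (X : Matrix ι ι A) (M : Matrix (ι × ι) (ι × ι) A) (x y : ι × ι) :
    (leg1 X * M) x y = ∑ a, X x.1 a * M (a, x.2) y := by
  simp [Matrix.mul_apply, Fintype.sum_prod_type, leg1_apply]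

theorem sandwich_apply (R : Matrix (ι × ι) (ι × ι) K) (X Y : Matrix ι ι A) (x y : ι × ι) :
    (leg1 X * scal A R * leg1 Y) x y =
      ∑ a, ∑ b, R (a, x.2) (b, y.2) • (X x.1 a * Y b y.1) := by
  rw [mul_assoc, leg1_mul_apply]
  simp [scal_mul_apply, Fintype.sum_prod_type, leg1_apply, Finset.mul_sum]

theorem derComm_apply (R : Matrix (ι × ι) (ι × ι) K) (D : Matrix ι ι A) (x y : ι × ι) :
    derComm R D x y = ∑ z, R x z • ∑ a, ∑ b, R⁻¹ (a, z.2) (b, y.2) • (D z.1 a * D b y.1) -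
      ∑ z, R z y • ∑ a, ∑ b, R⁻¹ (a, x.2) (b, z.2) • (D x.1 a * D b z.1) := by
  rw [derComm, Matrix.sub_apply, scal_mul_apply, mul_scal_apply]
  simp only [sandwich_apply]

theorem wide_entry_left (R : Matrix (ι × ι) (ι × ι) K) (M : Matrix (ι × ι) (ι × ι) A)
    (X : Matrix ι ι A) (x y : ι × ι × ι) :
    (ext12 K (leg1 X) * ext12 K (scal A R) * ext23 K (scal A R) * ext12 K M) x y =
      ∑ d, ∑ e, R (d, x.2.2) (e, y.2.2) • ∑ a, ∑ c, R (a, x.2.1) (c, d) •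
        (X x.1 a * M (c, e) (y.1, y.2.1)) := by
  obtain ⟨x1, x2, x3⟩ := x
  obtain ⟨y1, y2, y3⟩ := y
  have h1 (z1 z2 z3 : ι) : (ext12 K (leg1 X) * ext12 K (scal A R)) (x1, x2, x3) (z1, z2, z3) =
      if x3 = z3 then ∑ a, R (a, x2) (z1, z2) • X x1 a else 0 := by
    by_cases h : x3 = z3 <;>
    simp [Matrix.mul_apply, Fintype.sum_prod_type, ext12_apply, leg1_apply, scal,
      Algebra.smul_def, Algebra.commutes, h]
  have h2 (z1 z2 z3 : ι) : (ext23 K (scal A R) * ext12 K M) (z1, z2, z3) (y1, y2, y3) =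
      ∑ e, R (z2, z3) (e, y3) • M (z1, e) (y1, y2) := by
    simp [Matrix.mul_apply, Fintype.sum_prod_type, ext12_apply, ext23_apply, scal,
      Algebra.smul_def]
  rw [mul_assoc, Matrix.mul_apply]
  simp only [Fintype.sum_prod_type, h1, h2]
  simp only [ite_mul, zero_mul, Finset.sum_ite_eq, Finset.mem_univ, if_true]
  simp only [Finset.sum_mul_sum, Finset.smul_sum, smul_mul_smul_comm, smul_smul]
  rw [Finset.sum_comm]
  refine Finset.sum_congr rfl fun d _ => ?_
  rw [sum_three_rev]
  simp only [mul_comm]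

theorem permMatrix_map (φ : A →ₐ[K] A') (R : Matrix (ι × ι) (ι × ι) K) (ħ : K)
    (N D : Matrix ι ι A) :
    (permMatrix R ħ N D).map φ = permMatrix R ħ (N.map φ) (D.map φ) := by
  have h : ∀ M : Matrix (ι × ι) (ι × ι) A, M.map φ = φ.mapMatrix M := fun _ => rfl
  have h1 := leg1_map φ D
  have h2 := scal_map φ R⁻¹
  have h3 := leg1_map φ N
  have h4 := scal_map φ R
  rw [h] at h1 h2 h3 h4
  rw [h, permMatrix, permMatrix]
  simp only [map_sub, map_mul, map_smul, h1, h2, h3, h4]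

end Entries

/-! ### Induction in algebras given by generators. -/

section Induction

variable {K : Type*} [Field K] {X : Type*}

/-- Only left multiplication by generators occurs in the induction step, which is the form in which
derivatives meet an element of `𝒩`. -/
theorem ringQuot_induction (r : FreeAlgebra K X → FreeAlgebra K X → Prop)
    {C : RingQuot r → Prop} (one : C 1) (add : ∀ f g, C f → C g → C (f + g))
    (smul : ∀ (c : K) f, C f → C (c • f))
    (gen_mul : ∀ i f, C f → C (RingQuot.mkAlgHom K r (FreeAlgebra.ι K i) * f)) (f : RingQuot r) :
    C f := by
  have h (w : FreeAlgebra K X) : ∀ f, C f → C (RingQuot.mkAlgHom K r w * f) := by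
    refine FreeAlgebra.induction K X (motive := fun w => ∀ f, C f → C (RingQuot.mkAlgHom K r w * f))
      (fun c f hf => ?_) gen_mul (fun a b ha hb f hf => ?_) (fun a b ha hb f hf => ?_) w
    · rw [AlgHom.commutes, ← Algebra.smul_def]
      exact smul c f hf
    · rw [map_mul, mul_assoc]
      exact ha _ (hb _ hf)
    · rw [map_add, add_mul]
      exact add _ _ (ha _ hf) (hb _ hf)
  obtain ⟨w, rfl⟩ := RingQuot.mkAlgHom_surjective K r f
  simpa using h w 1 one

end Induction

/-! ### Generators, relations and universal properties. -/

section Generators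

variable {K : Type*} [Field K] {ι : Type*} [Fintype ι] [DecidableEq ι]
  (R : Matrix (ι × ι) (ι × ι) K) (ħ : K)

/-- The generators of the modified Reflection Equation algebra. -/
def mreN : Matrix ι ι (MREAlg R ħ) := (freeGen K ι).map (RingQuot.mkAlgHom K (mRERel R ħ))

/-- The generators of the algebra of partial derivatives. -/
def derD : Matrix ι ι (DerAlg R) := (freeGen K ι).map (RingQuot.mkAlgHom K (derRel R))

theorem mreN_rel : mREMatrix R ħ (mreN R ħ) = 0 := by
  rw [mreN, ← mREMatrix_map]
  ext a b
  rw [Matrix.map_apply, Matrix.zero_apply, ← map_zero (RingQuot.mkAlgHom K (mRERel R ħ))]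
  exact RingQuot.mkAlgHom_rel K ⟨rfl, a, b, rfl⟩

theorem derD_rel : derMatrix R (derD R) = 0 := by
  rw [derD, ← derMatrix_map]
  ext a b
  rw [Matrix.map_apply, Matrix.zero_apply, ← map_zero (RingQuot.mkAlgHom K (derRel R))]
  exact RingQuot.mkAlgHom_rel K ⟨rfl, a, b, rfl⟩

theorem weyl_perm : permMatrix R ħ (weylN R ħ) (weylD R ħ) = 0 := by
  rw [weylN, weylD, ← permMatrix_map]
  ext a b
  rw [Matrix.map_apply, Matrix.zero_apply, ← map_zero (RingQuot.mkAlgHom K (weylRel R ħ))]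
  exact RingQuot.mkAlgHom_rel K ⟨rfl, a, b, Or.inr (Or.inr rfl)⟩

variable {R ħ}

theorem mre_induction {C : MREAlg R ħ → Prop} (one : C 1)
    (add : ∀ f g, C f → C g → C (f + g)) (smul : ∀ (c : K) f, C f → C (c • f))
    (gen_mul : ∀ i j f, C f → C (mreN R ħ i j * f)) (f : MREAlg R ħ) : C f :=
  ringQuot_induction (mRERel R ħ) one add smul (fun p => gen_mul p.1 p.2) f

theorem der_induction {C : DerAlg R → Prop} (one : C 1)
    (add : ∀ f g, C f → C g → C (f + g)) (smul : ∀ (c : K) f, C f → C (c • f))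
    (gen_mul : ∀ i j f, C f → C (derD R i j * f)) (f : DerAlg R) : C f :=
  ringQuot_induction (derRel R) one add smul (fun p => gen_mul p.1 p.2) f

theorem mRELift_mreN {A : Type*} [Ring A] [Algebra K A] (N : Matrix ι ι A)
    (hN : mREMatrix R ħ N = 0) (i j : ι) : mRELift R ħ N hN (mreN R ħ i j) = N i j := by
  rw [mreN, Matrix.map_apply, mRELift, RingQuot.liftAlgHom_mkAlgHom_apply, freeGen,
    FreeAlgebra.lift_ι_apply]

theorem derLift_derD {A : Type*} [Ring A] [Algebra K A] (D : Matrix ι ι A)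
    (hD : derMatrix R D = 0) (i j : ι) : derLift R D hD (derD R i j) = D i j := by
  rw [derD, Matrix.map_apply, derLift, RingQuot.liftAlgHom_mkAlgHom_apply, freeGen,
    FreeAlgebra.lift_ι_apply]

end Generators

/-! ### Transport of the reflection equation through a derivative. -/

section Shift

variable {K : Type*} [Field K] {ι : Type*} [Fintype ι] [DecidableEq ι]
  {R Ψ : Matrix (ι × ι) (ι × ι) K} {q ħ : K}
  {A : Type*} [Ring A] [Algebra K A]

theorem derMatrix_eq (hR : IsHeckeSymmetry R q) (D : Matrix ι ι A) :
    derMatrix R D = - (scal A R⁻¹ * derComm R D * scal A R⁻¹) := by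
  have h1 : scal A R * scal A R⁻¹ = 1 := by
    rw [← scal_mul, Matrix.mul_nonsing_inv R hR.isUnit_det, scal_one]
  have h2 : scal A R⁻¹ * scal A R = 1 := by
    rw [← scal_mul, Matrix.nonsing_inv_mul R hR.isUnit_det, scal_one]
  rw [derMatrix, derComm]
  linear_combination (norm := noncomm_ring)
    - scal A R⁻¹ * leg1 D * scal A R⁻¹ * leg1 D * h1 + h2 * leg1 D * scal A R⁻¹ * leg1 D *
      scal A R⁻¹

theorem derComm_eq (hR : IsHeckeSymmetry R q) (D : Matrix ι ι A) :
    derComm R D = - (scal A R * derMatrix R D * scal A R) := by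
  have h1 : scal A R * scal A R⁻¹ = 1 := by
    rw [← scal_mul, Matrix.mul_nonsing_inv R hR.isUnit_det, scal_one]
  have h2 : scal A R⁻¹ * scal A R = 1 := by
    rw [← scal_mul, Matrix.nonsing_inv_mul R hR.isUnit_det, scal_one]
  rw [derMatrix, derComm]
  linear_combination (norm := noncomm_ring)
    h1 * leg1 D * scal A R⁻¹ * leg1 D * scal A R - scal A R * leg1 D * scal A R⁻¹ * leg1 D * h2

/-- If derivatives are exchanged with matrices `N` and `N'` that are intertwined by `u`, then the
reflection equation for `N` passes on to the products of the derivatives with that for `N'`. -/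
theorem mul_mREMatrix_eq_zero (hq : q ≠ 0) (hR : IsHeckeSymmetry R q) (hΨ : IsSkewInverse R Ψ)
    {N N' D : Matrix ι ι A} {u : A} (hN : mREMatrix R ħ N = 0)
    (hu : ∀ i j, u * N' i j = N i j * u)
    (H : leg1 D * scal A R * leg1 N' = scal A R * leg1 N * scal A R⁻¹ * leg1 D * scal A R⁻¹ +
      diagElt _ u + ħ • leg1 D) (i j : ι) (x y : ι × ι) :
    D i j * mREMatrix R ħ N' x y = 0 := by
  obtain ⟨ha, ha', hb, hb'⟩ := ext_mul_inv (A := A) hR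
  have h2 : scal A R⁻¹ * scal A R = 1 := by
    rw [← scal_mul, Matrix.nonsing_inv_mul R hR.isUnit_det, scal_one]
  have H1 : leg1 D * scal A R * leg1 N' * scal A R =
      scal A R * leg1 N * scal A R⁻¹ * leg1 D + diagElt _ u * scal A R +
        ħ • (leg1 D * scal A R) := by
    rw [H, add_mul, add_mul, smul_mul_assoc, mul_assoc _ (scal A R⁻¹) (scal A R), h2, mul_one]
  have H2 := congrArg (ext12 K) H1
  simp only [map_add, map_mul, map_smul] at H2
  have hau : ext12 K (scal A R) * ext12 K (diagElt _ u) =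
      ext12 K (diagElt _ u) * ext12 K (scal A R) := ext12_diagElt_comm12 u R
  have hun : ext12 K (diagElt _ u) * ext12 K (leg1 N') =
      ext12 K (leg1 N) * ext12 K (diagElt _ u) := by
    rw [← map_mul, diagElt_leg1 hu, map_mul]
  have key := derivative_past_mRE ħ ha ha' hb hb' (ext_sub_inv hq hR) (ext_braid hR)
    (ext23_scal_comm_leg1 R N) (ext23_scal_comm_leg1 R N') (ext23_scal_comm_leg1 R D)
    hau (ext12_diagElt_comm23 u R) hun H2
  have hM (X : Matrix ι ι A) : ext12 K (mREMatrix R ħ X) =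
      ext12 K (scal A R) * ext12 K (leg1 X) * ext12 K (scal A R) * ext12 K (leg1 X) -
      ext12 K (leg1 X) * ext12 K (scal A R) * ext12 K (leg1 X) * ext12 K (scal A R) -
      ħ • (ext12 K (scal A R) * ext12 K (leg1 X) - ext12 K (leg1 X) * ext12 K (scal A R)) := by
    simp only [mREMatrix, map_sub, map_mul, map_smul]
  rw [← hM, ← hM, hN, map_zero] at key
  -- The relation for `N` kills the right side of `key`. The factors `R₂₃ R₁₂` on the right are
  -- cancelled as invertible; those between `D₁` and the relation are then stripped by
  -- skew-invertibility.
  have k2 : ext12 K (leg1 D) * ext12 K (scal A R) * ext23 K (scal A R) *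
      ext12 K (mREMatrix R ħ N') = 0 := by
    linear_combination (norm := noncomm_ring) key * ext12 K (scal A R⁻¹) * ext23 K (scal A R⁻¹)
      - ext12 K (leg1 D) * ext12 K (scal A R) * ext23 K (scal A R) *
        ext12 K (mREMatrix R ħ N') * hb
      - ext12 K (leg1 D) * ext12 K (scal A R) * ext23 K (scal A R) *
        ext12 K (mREMatrix R ħ N') * ext23 K (scal A R) * ha * ext23 K (scal A R⁻¹)
  have h3 (i j j1 j2 d e : ι) : ∑ a, ∑ c, R (a, j) (c, d) •
      (D i a * mREMatrix R ħ N' (c, e) (j1, j2)) ∈ (⊥ : Submodule K A) := by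
    refine hΨ.mem_of_sum_mem ⊥ (fun d e => ∑ a, ∑ c, R (a, j) (c, d) •
      (D i a * mREMatrix R ħ N' (c, e) (j1, j2))) (fun x3 y3 => ?_) d e
    rw [← wide_entry_left R (mREMatrix R ħ N') D (i, j, x3) (j1, j2, y3), k2]
    exact Submodule.zero_mem _
  exact (Submodule.mem_bot K).1 (hΨ.mem_of_sum_mem ⊥
    (fun a c => D i a * mREMatrix R ħ N' (c, x.2) y) (fun j' d => h3 i j' y.1 y.2 d x.2) j x.1)

end Shift
-- Row vectors `(1, ∂)` over `𝒩`, and the matrices that move them past generators.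
section Representation

variable {K : Type*} [Field K] {ι : Type*} [Fintype ι] [DecidableEq ι]
  (R Ψ : Matrix (ι × ι) (ι × ι) K) (ħ : K)

/-- Matrices over the modified Reflection Equation algebra, with rows and columns indexed by
`1` and the partial derivatives. -/
abbrev ShiftAlg := Matrix (Option (ι × ι)) (Option (ι × ι)) (MREAlg R ħ)

/-- The row vector `∂_i^j`, as a matrix whose other rows vanish. -/
def shiftD : Matrix ι ι (ShiftAlg R ħ) := fun i j => Matrix.single none (some (i, j)) 1

/-- The row vector `1`, as a matrix whose other rows vanish. -/
def shiftUnit : ShiftAlg R ħ := Matrix.single none none 1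

/-- Left multiplication of row vectors by the generators. -/
def shiftN : Matrix ι ι (ShiftAlg R ħ) :=
  (mreN R ħ).map (Matrix.scalarAlgHom (Option (ι × ι)) K)

/-- The right-hand side of the permutation relations. -/
noncomputable def shiftRhs : Matrix (ι × ι) (ι × ι) (ShiftAlg R ħ) :=
  scal _ R * leg1 (shiftN R ħ) * scal _ R⁻¹ * leg1 (shiftD R ħ) * scal _ R⁻¹ +
    diagElt _ (shiftUnit R ħ) + ħ • leg1 (shiftD R ħ)

/-- The products `∂_i^y n_x^j`, expressed by means of the permutation relations. -/
noncomputable def shiftProd (i y x j : ι) : ShiftAlg R ħ :=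
  ∑ i', ∑ j', Ψ (j', x) (i', y) • shiftRhs R ħ (i, i') (j, j')

/-- The matrices by which the row vector `(1, ∂)` is moved past a generator. -/
noncomputable def shiftX : Matrix ι ι (ShiftAlg R ħ) := fun x j α γ =>
  α.elim (if γ = none then mreN R ħ x j else 0) fun p => shiftProd R Ψ ħ p.1 p.2 x j none γ

variable {R Ψ ħ} {q : K}

theorem shiftN_rel : mREMatrix R ħ (shiftN R ħ) = 0 := by
  rw [shiftN, ← mREMatrix_map, mreN_rel]
  ext a b
  simp

theorem shiftUnit_mul_apply (t : ShiftAlg R ħ) (γ : Option (ι × ι)) :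
    (shiftUnit R ħ * t) none γ = t none γ := by
  simp [shiftUnit]

/-- A matrix fixed by left multiplication with `shiftUnit` has only the row `none`, so it is a row
vector. -/
theorem eq_of_shiftUnit_mul {t t' : ShiftAlg R ħ} (h : shiftUnit R ħ * t = t)
    (h' : shiftUnit R ħ * t' = t') (e : ∀ γ, t none γ = t' none γ) : t = t' := by
  rw [← h, ← h']
  ext α γ
  by_cases hα : α = none
  · subst hα
    simp only [shiftUnit_mul_apply, e]
  · rw [shiftUnit, Matrix.single_mul_apply_of_ne _ _ _ _ _ hα,
      Matrix.single_mul_apply_of_ne _ _ _ _ _ hα]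

theorem shiftUnit_shiftD (i j : ι) : shiftUnit R ħ * shiftD R ħ i j = shiftD R ħ i j := by
  simp [shiftUnit, shiftD]

theorem shiftUnit_mul_eq {t : ShiftAlg R ħ} {n : MREAlg R ħ}
    (h : ∀ γ, t none γ = if γ = none then n else 0) :
    shiftUnit R ħ * t = Matrix.scalarAlgHom (Option (ι × ι)) K n * shiftUnit R ħ := by
  rw [Matrix.scalarAlgHom_apply, Matrix.scalar_apply]
  ext α γ
  rw [Matrix.diagonal_mul]
  by_cases hα : α = none
  · subst hα
    rw [shiftUnit_mul_apply, h]
    by_cases hγ : γ = none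
    · simp [hγ, shiftUnit]
    · simp [hγ, shiftUnit, eq_comm]
  · rw [shiftUnit, Matrix.single_mul_apply_of_ne _ _ _ _ _ hα, Matrix.single_apply,
      if_neg (fun h => hα h.1.symm), mul_zero]

theorem shiftUnit_shiftN (i j : ι) :
    shiftUnit R ħ * shiftN R ħ i j = shiftN R ħ i j * shiftUnit R ħ := by
  refine shiftUnit_mul_eq fun γ => ?_
  simp [shiftN, Matrix.scalar_apply, Matrix.diagonal_apply, eq_comm]

theorem shiftUnit_shiftX (i j : ι) :
    shiftUnit R ħ * shiftX R Ψ ħ i j = shiftN R ħ i j * shiftUnit R ħ :=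
  shiftUnit_mul_eq fun _ => rfl

theorem shiftUnit_shiftRhs (x y : ι × ι) :
    shiftUnit R ħ * shiftRhs R ħ x y = shiftRhs R ħ x y := by
  have h1 : diagElt _ (shiftUnit R ħ) * shiftRhs R ħ = shiftRhs R ħ := by
    have e1 : diagElt _ (shiftUnit R ħ) * leg1 (shiftN R ħ) =
        leg1 (shiftN R ħ) * diagElt _ (shiftUnit R ħ) := diagElt_leg1 shiftUnit_shiftN
    have e2 : diagElt _ (shiftUnit R ħ) * leg1 (shiftD R ħ) = leg1 (shiftD R ħ) := by
      refine Matrix.ext fun x y => ?_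
      rw [diagElt, Matrix.diagonal_mul, leg1_apply]
      split_ifs
      exacts [shiftUnit_shiftD _ _, mul_zero _]
    have e3 : diagElt _ (shiftUnit R ħ) * diagElt (ι × ι) (shiftUnit R ħ) =
        diagElt _ (shiftUnit R ħ) := by
      simp [diagElt, shiftUnit]
    have e4 := diagElt_scal (n := ι × ι) (shiftUnit R ħ) R
    have e5 := diagElt_scal (n := ι × ι) (shiftUnit R ħ) R⁻¹
    rw [shiftRhs, mul_add, mul_add, mul_smul_comm, e2, e3]
    congr 2
    linear_combination (norm := noncomm_ring)
      - e4 * leg1 (shiftN R ħ) * scal _ R⁻¹ * leg1 (shiftD R ħ) * scal _ R⁻¹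
      + scal _ R * e1 * scal _ R⁻¹ * leg1 (shiftD R ħ) * scal _ R⁻¹
      - scal _ R * leg1 (shiftN R ħ) * e5 * leg1 (shiftD R ħ) * scal _ R⁻¹
      + scal _ R * leg1 (shiftN R ħ) * scal _ R⁻¹ * e2 * scal _ R⁻¹
  have h2 := congrFun (congrFun h1 x) y
  rwa [diagElt, Matrix.diagonal_mul] at h2

theorem shiftD_mul_shiftX (i y x j : ι) :
    shiftD R ħ i y * shiftX R Ψ ħ x j = shiftProd R Ψ ħ i y x j := by
  refine eq_of_shiftUnit_mul ?_ ?_ fun γ => ?_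
  · rw [← mul_assoc, shiftUnit_shiftD]
  · simp only [shiftProd, Finset.mul_sum, mul_smul_comm, shiftUnit_shiftRhs]
  · simp [shiftD, shiftX]

theorem shift_perm (hΨ : IsSkewInverse R Ψ) :
    leg1 (shiftD R ħ) * scal _ R * leg1 (shiftX R Ψ ħ) = shiftRhs R ħ := by
  refine Matrix.ext fun x y => ?_
  rw [sandwich_apply]
  simp only [shiftD_mul_shiftX, shiftProd]
  exact hΨ.sum_sum (fun i' j' => shiftRhs R ħ (x.1, i') (y.1, j')) x.2 y.2

/-- The relation is checked row by row. Row `none` reduces to the relation in `𝒩` because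
`shiftUnit` intertwines `shiftX` with `shiftN`; the row of a derivative is `mul_mREMatrix_eq_zero`.
-/
theorem shiftX_rel (hq : q ≠ 0) (hR : IsHeckeSymmetry R q) (hΨ : IsSkewInverse R Ψ) :
    mREMatrix R ħ (shiftX R Ψ ħ) = 0 := by
  have h1 := mul_mREMatrix_eq_zero hq hR hΨ shiftN_rel (shiftUnit_shiftX (Ψ := Ψ))
    (shift_perm (ħ := ħ) hΨ)
  have e1 : diagElt (ι × ι) (shiftUnit R ħ) * leg1 (shiftX R Ψ ħ) =
        leg1 (shiftN R ħ) * diagElt _ (shiftUnit R ħ) := diagElt_leg1 shiftUnit_shiftX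
  have h2 : diagElt (ι × ι) (shiftUnit R ħ) * mREMatrix R ħ (shiftX R Ψ ħ) =
      mREMatrix R ħ (shiftN R ħ) * diagElt _ (shiftUnit R ħ) := by
    have e4 := diagElt_scal (n := ι × ι) (shiftUnit R ħ) R
    simp only [mREMatrix]
    generalize diagElt (ι × ι) (shiftUnit R ħ) = u at *
    generalize leg1 (shiftX R Ψ ħ) = x at *
    generalize leg1 (shiftN R ħ) = n at *
    generalize scal (ShiftAlg R ħ) R = r at *
    linear_combination (norm := (simp only [mul_sub, sub_mul, smul_mul_assoc,
        mul_smul_comm, smul_sub, mul_assoc]; module))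
      - e4 * x * r * x + r * e1 * r * x - r * n * e4 * x + r * n * r * e1
      - e1 * r * x * r + n * e4 * x * r - n * r * e1 * r + n * r * n * e4
      - ħ • (- e4 * x + r * e1 - e1 * r + n * e4)
  rw [shiftN_rel, zero_mul] at h2
  ext x y α γ
  match α with
  | none =>
    have h3 := congrFun (congrFun h2 x) y
    rw [diagElt, Matrix.diagonal_mul] at h3
    have h4 := congrFun (congrFun h3 none) γ
    rwa [shiftUnit_mul_apply] at h4
  | some (i, j) =>
    have h4 := congrFun (congrFun (h1 i j x y) none) γ
    simpa [shiftD] using h4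

end Representation
-- Operators on `𝒩 ⊗ 𝒟` and the permutation relations.
section Representation

variable {K : Type*} [Field K] {ι : Type*} [Fintype ι] [DecidableEq ι]
  {R Ψ : Matrix (ι × ι) (ι × ι) K} {q ħ : K}

/-- The matrices by which the row vector `(1, ∂)` is moved past an element of `N(q, ħ)`. -/
noncomputable def shiftHom (hX : mREMatrix R ħ (shiftX R Ψ ħ) = 0) :
    MREAlg R ħ →ₐ[K] ShiftAlg R ħ := mRELift R ħ (shiftX R Ψ ħ) hX

theorem shiftHom_mreN (hX : mREMatrix R ħ (shiftX R Ψ ħ) = 0) (i j : ι) :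
    shiftHom hX (mreN R ħ i j) = shiftX R Ψ ħ i j := mRELift_mreN _ hX i j

/-- The elements `1` and `∂_i^j` of the algebra of partial derivatives. -/
def oneD (R : Matrix (ι × ι) (ι × ι) K) (β : Option (ι × ι)) : DerAlg R :=
  β.elim 1 fun p => derD R p.1 p.2

theorem shiftUnit_shiftHom (hX : mREMatrix R ħ (shiftX R Ψ ħ) = 0) (f : MREAlg R ħ) :
    shiftUnit R ħ * shiftHom hX f =
      Matrix.scalarAlgHom (Option (ι × ι)) K f * shiftUnit R ħ := by
  refine mre_induction (C := fun f => shiftUnit R ħ * shiftHom hX f =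
    Matrix.scalarAlgHom (Option (ι × ι)) K f * shiftUnit R ħ) ?_ (fun f g hf hg => ?_)
    (fun c f hf => ?_) (fun i j f hf => ?_) f
  · rw [map_one, map_one, one_mul, mul_one]
  · rw [map_add, map_add, mul_add, add_mul, hf, hg]
  · rw [map_smul, map_smul, mul_smul_comm, smul_mul_assoc, hf]
  · rw [map_mul, map_mul, ← mul_assoc, mul_assoc _ _ (shiftUnit R ħ), ← hf,
      shiftHom_mreN, shiftUnit_shiftX, mul_assoc]
    rfl

theorem shiftHom_none (hX : mREMatrix R ħ (shiftX R Ψ ħ) = 0) (f : MREAlg R ħ)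
    (γ : Option (ι × ι)) : shiftHom hX f none γ = if γ = none then f else 0 := by
  have h := congrFun (congrFun (shiftUnit_shiftHom hX f) none) γ
  rw [shiftUnit_mul_apply, Matrix.scalarAlgHom_apply, Matrix.scalar_apply,
    Matrix.diagonal_mul] at h
  rw [h, shiftUnit, Matrix.single_apply]
  by_cases hγ : γ = none <;> simp [hγ, eq_comm]

/-- The operator on `N(q, ħ) ⊗ 𝒟` attached to a row vector. -/
noncomputable def rowOp (hX : mREMatrix R ħ (shiftX R Ψ ħ) = 0) :
    ShiftAlg R ħ →ₗ[K] Module.End K (MREAlg R ħ ⊗[K] DerAlg R) where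
  toFun t := ∑ β, TensorProduct.map
    (Matrix.entryLinearMap K (MREAlg R ħ) none β ∘ₗ LinearMap.mulLeft K t ∘ₗ
      (shiftHom hX).toLinearMap) (LinearMap.mulLeft K (oneD R β))
  map_add' t t' := by
    rw [← Finset.sum_add_distrib]
    refine Finset.sum_congr rfl fun β _ => ?_
    rw [← TensorProduct.map_add_left]
    congr 1
    ext f
    simp [add_mul]
  map_smul' c t := by
    rw [RingHom.id_apply, Finset.smul_sum]
    refine Finset.sum_congr rfl fun β _ => ?_
    rw [← TensorProduct.map_smul_left]
    congr 1
    ext f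
    simp

theorem rowOp_tmul (hX : mREMatrix R ħ (shiftX R Ψ ħ) = 0) (t : ShiftAlg R ħ)
    (f : MREAlg R ħ) (x : DerAlg R) :
    rowOp hX t (f ⊗ₜ x) = ∑ β, (t * shiftHom hX f) none β ⊗ₜ (oneD R β * x) := by
  simp [rowOp, LinearMap.sum_apply]

/-- Subtraction makes the endomorphisms a ring, over which the matrix identities are stated. -/
noncomputable instance tensorAddCommGroup :
    AddCommGroup (MREAlg R ħ ⊗[K] DerAlg R) := Module.addCommMonoidToAddCommGroup K

/-- Left multiplication by elements of `N(q, ħ)` on `N(q, ħ) ⊗ 𝒟`. -/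
noncomputable def leftOp (R : Matrix (ι × ι) (ι × ι) K) (ħ : K) :
    MREAlg R ħ →ₐ[K] Module.End K (MREAlg R ħ ⊗[K] DerAlg R) :=
  (Module.End.rTensorAlgHom K (MREAlg R ħ) (DerAlg R)).comp (Algebra.lmul K (MREAlg R ħ))

theorem leftOp_tmul (g f : MREAlg R ħ) (x : DerAlg R) :
    leftOp R ħ g (f ⊗ₜ x) = (g * f) ⊗ₜ x := rfl

/-- The operators of the generators `n_i^j`. -/
noncomputable def opN (R : Matrix (ι × ι) (ι × ι) K) (ħ : K) :
    Matrix ι ι (Module.End K (MREAlg R ħ ⊗[K] DerAlg R)) := (mreN R ħ).map (leftOp R ħ)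

/-- The operators of the derivatives `∂_i^j`. -/
noncomputable def opD (hX : mREMatrix R ħ (shiftX R Ψ ħ) = 0) :
    Matrix ι ι (Module.End K (MREAlg R ħ ⊗[K] DerAlg R)) := (shiftD R ħ).map (rowOp hX)

theorem rowOp_mul_shiftX (hX : mREMatrix R ħ (shiftX R Ψ ħ) = 0) (t : ShiftAlg R ħ) (i j : ι) :
    rowOp hX (t * shiftX R Ψ ħ i j) = rowOp hX t * opN R ħ i j := by
  refine TensorProduct.ext' fun f x => ?_
  rw [Module.End.mul_apply, opN, Matrix.map_apply, leftOp_tmul, rowOp_tmul, rowOp_tmul, map_mul,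
    shiftHom_mreN, mul_assoc]

theorem rowOp_scalar_mul (hX : mREMatrix R ħ (shiftX R Ψ ħ) = 0) (t : ShiftAlg R ħ) (i j : ι) :
    rowOp hX (shiftN R ħ i j * t) = opN R ħ i j * rowOp hX t := by
  refine TensorProduct.ext' fun f x => ?_
  rw [Module.End.mul_apply, rowOp_tmul, rowOp_tmul, map_sum]
  refine Finset.sum_congr rfl fun β _ => ?_
  rw [opN, Matrix.map_apply, leftOp_tmul, shiftN, Matrix.map_apply, Matrix.scalarAlgHom_apply,
    Matrix.scalar_apply, mul_assoc, Matrix.diagonal_mul]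

theorem rowOp_shiftUnit (hX : mREMatrix R ħ (shiftX R Ψ ħ) = 0) :
    rowOp hX (shiftUnit R ħ) = 1 := by
  refine TensorProduct.ext' fun f x => ?_
  rw [rowOp_tmul]
  simp only [shiftUnit_mul_apply, shiftHom_none]
  simp [TensorProduct.ite_tmul, oneD]

theorem opD_one_tmul (hX : mREMatrix R ħ (shiftX R Ψ ħ) = 0) (i j : ι) (x : DerAlg R) :
    opD hX i j (1 ⊗ₜ x) = 1 ⊗ₜ (derD R i j * x) := by
  rw [opD, Matrix.map_apply, rowOp_tmul, map_one, mul_one]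
  rw [Finset.sum_eq_single (some (i, j))]
  · simp [shiftD, oneD]
  · intro β _ hβ
    rw [shiftD, Matrix.single_apply, if_neg fun h => hβ h.2.symm, TensorProduct.zero_tmul]
  · simp

section LinearImage

variable {A A' : Type*} [Ring A] [Algebra K A] [Ring A'] [Algebra K A'] (φ : A →ₗ[K] A')

theorem map_scal_mul {n : Type*} [Fintype n] (S : Matrix n n K) (M : Matrix n n A) :
    (scal A S * M).map φ = scal A' S * M.map φ := by
  ext x y
  simp [scal_mul_apply]

theorem map_mul_scal {n : Type*} [Fintype n] (S : Matrix n n K) (M : Matrix n n A) :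
    (M * scal A S).map φ = M.map φ * scal A' S := by
  ext x y
  simp [mul_scal_apply]

/-- The map `φ` is only linear, but the entries are scalar combinations of products of one entry of
`X` and one of `Y`. This is all that is needed for `rowOp`, which is not multiplicative. -/
theorem map_sandwich (S : Matrix (ι × ι) (ι × ι) K) {X Y : Matrix ι ι A} {X' Y' : Matrix ι ι A'}
    (h : ∀ i a b j, φ (X i a * Y b j) = X' i a * Y' b j) :
    (leg1 X * scal A S * leg1 Y).map φ = leg1 X' * scal A' S * leg1 Y' := by
  ext x y
  simp [sandwich_apply, h]

theorem leg1_map_linear (X : Matrix ι ι A) : (leg1 X).map φ = leg1 (X.map φ) := by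
  ext x y
  simp [leg1_apply, apply_ite φ]

end LinearImage

theorem op_perm (hR : IsHeckeSymmetry R q) (hΨ : IsSkewInverse R Ψ)
    (hX : mREMatrix R ħ (shiftX R Ψ ħ) = 0) :
    permMatrix R ħ (opN R ħ) (opD hX) = 0 := by
  have h1 := congrArg (fun M => M.map (rowOp hX)) (shift_perm (ħ := ħ) hΨ)
  have e1 : (scal (ShiftAlg R ħ) R * leg1 (shiftN R ħ) * scal (ShiftAlg R ħ) R⁻¹ *
      leg1 (shiftD R ħ) * scal (ShiftAlg R ħ) R⁻¹).map (rowOp hX) =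
      scal _ R * (leg1 (opN R ħ) * scal _ R⁻¹ * leg1 (opD hX)) * scal _ R⁻¹ := by
    rw [map_mul_scal, mul_assoc (scal _ R), mul_assoc (scal _ R), map_scal_mul,
      map_sandwich (rowOp hX) R⁻¹ fun i a b j => rowOp_scalar_mul hX _ i a]
    rfl
  have e2 : (diagElt (ι × ι) (shiftUnit R ħ)).map (rowOp hX) = 1 := by
    refine Matrix.ext fun x y => ?_
    rw [Matrix.map_apply, diagElt, Matrix.diagonal_apply, Matrix.one_apply]
    split_ifs
    exacts [rowOp_shiftUnit hX, map_zero _]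
  have e3 : (ħ • leg1 (shiftD R ħ)).map (rowOp hX) = ħ • leg1 (opD hX) := by
    have e := leg1_map_linear (rowOp hX) (shiftD R ħ)
    refine Matrix.ext fun x y => ?_
    rw [Matrix.map_apply, Matrix.smul_apply, map_smul, Matrix.smul_apply, opD, ← e,
      Matrix.map_apply]
  have e4 : (shiftRhs R ħ).map (rowOp hX) =
      scal _ R * (leg1 (opN R ħ) * scal _ R⁻¹ * leg1 (opD hX)) * scal _ R⁻¹ + 1 +
        ħ • leg1 (opD hX) := by
    rw [← e1, ← e2, ← e3, shiftRhs]
    refine Matrix.ext fun x y => ?_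
    simp only [Matrix.map_apply, Matrix.add_apply, map_add]
  have h2 : leg1 (opD hX) * scal _ R * leg1 (opN R ħ) = _ :=
    (map_sandwich (rowOp hX) R fun i a b j => rowOp_mul_shiftX hX _ b j).symm.trans (h1.trans e4)
  have h3 : scal (Module.End K (MREAlg R ħ ⊗[K] DerAlg R)) R⁻¹ * scal _ R = 1 := by
    rw [← scal_mul, Matrix.nonsing_inv_mul R hR.isUnit_det, scal_one]
  rw [permMatrix, h2, add_mul, add_mul, mul_assoc _ (scal _ R⁻¹) (scal _ R), h3, mul_one, one_mul,
    smul_mul_assoc]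
  simp only [mul_assoc]
  abel

end Representation
-- The action of the braided Weyl algebra, and injectivity.
section Representation

variable {K : Type*} [Field K] {ι : Type*} [Fintype ι] [DecidableEq ι]
  {R Ψ : Matrix (ι × ι) (ι × ι) K} {q ħ : K}

theorem op_derComm (hq : q ≠ 0) (hR : IsHeckeSymmetry R q) (hΨ : IsSkewInverse R Ψ)
    (hX : mREMatrix R ħ (shiftX R Ψ ħ) = 0) : derComm R (opD hX) = 0 := by
  refine Matrix.ext fun p r => TensorProduct.ext' fun f x => ?_
  have h0 : derComm R (derD R) = 0 := by
    rw [derComm_eq hR, derD_rel, mul_zero, zero_mul, neg_zero]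
  -- The left ideal is the annihilator of `1 ⊗ x`. On `1 ⊗ x` the derivatives act by left
  -- multiplication in `𝒟`, which starts the induction; evaluating at `1 ⊗ x` after the operator of
  -- `f` gives all of `f ⊗ x`.
  have key : EntriesIn (LinearMap.ker (LinearMap.toSpanSingleton
      (Module.End K (MREAlg R ħ ⊗[K] DerAlg R)) (MREAlg R ħ ⊗[K] DerAlg R) (1 ⊗ₜ x)))
      (derComm R (opD hX) * diagElt _ (leftOp R ħ f)) := by
    refine mre_induction (C := fun f => EntriesIn (LinearMap.ker (LinearMap.toSpanSingleton
      (Module.End K (MREAlg R ħ ⊗[K] DerAlg R)) (MREAlg R ħ ⊗[K] DerAlg R) (1 ⊗ₜ x)))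
      (derComm R (opD hX) * diagElt _ (leftOp R ħ f)))
      ?_ (fun f g hf hg p r => ?_) (fun c f hf p r => ?_) (fun i j f hf => ?_) f
    · intro p r
      rw [mul_diagElt_apply, map_one, mul_one, LinearMap.mem_ker,
        LinearMap.toSpanSingleton_apply, derComm_apply]
      have h1 := congrFun (congrFun h0 p) r
      rw [derComm_apply, Matrix.zero_apply, sub_eq_zero] at h1
      have h2 := congrArg (fun z => (1 : MREAlg R ħ) ⊗ₜ[K] (z * x)) h1
      simp only [Finset.sum_mul, smul_mul_assoc, TensorProduct.tmul_sum, TensorProduct.tmul_smul,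
        mul_assoc] at h2
      rw [Module.End.smul_def, LinearMap.sub_apply, sub_eq_zero]
      simp only [LinearMap.sum_apply, LinearMap.smul_apply, Module.End.mul_apply, opD_one_tmul]
      exact h2
    · have := Submodule.add_mem _ (hf p r) (hg p r)
      rwa [mul_diagElt_apply, mul_diagElt_apply, ← mul_add, ← map_add, ← mul_diagElt_apply] at this
    · have := Submodule.smul_of_tower_mem _ c (hf p r)
      rwa [mul_diagElt_apply, ← mul_smul_comm, ← map_smul, ← mul_diagElt_apply] at this
    · rw [map_mul]
      exact derComm_mul_mem hq hR hΨ (op_perm hR hΨ hX) _ _ hf i j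
  have h := key p r
  rw [mul_diagElt_apply, LinearMap.mem_ker, LinearMap.toSpanSingleton_apply,
    Module.End.smul_def, Module.End.mul_apply, leftOp_tmul, mul_one] at h
  exact h

theorem op_der (hq : q ≠ 0) (hR : IsHeckeSymmetry R q) (hΨ : IsSkewInverse R Ψ)
    (hX : mREMatrix R ħ (shiftX R Ψ ħ) = 0) : derMatrix R (opD hX) = 0 := by
  rw [derMatrix_eq hR, op_derComm hq hR hΨ, mul_zero, zero_mul, neg_zero]

/-- An algebra map out of the braided Weyl algebra, given by matrices that satisfy its
relations. -/
noncomputable def weylLift {A : Type*} [Ring A] [Algebra K A] {N D : Matrix ι ι A}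
    (hN : mREMatrix R ħ N = 0) (hD : derMatrix R D = 0) (hND : permMatrix R ħ N D = 0) :
    WeylAlg R ħ →ₐ[K] A :=
  RingQuot.liftAlgHom K ⟨FreeAlgebra.lift K (Sum.elim (fun p => N p.1 p.2) fun p => D p.1 p.2), by
    rintro x y ⟨rfl, a, b, h⟩
    have h1 : (freeN K ι).map (FreeAlgebra.lift K
        (Sum.elim (fun p : ι × ι => N p.1 p.2) fun p => D p.1 p.2)) = N := by
      ext i j
      simp [freeN]
    have h2 : (freeD K ι).map (FreeAlgebra.lift K
        (Sum.elim (fun p : ι × ι => N p.1 p.2) fun p => D p.1 p.2)) = D := by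
      ext i j
      simp [freeD]
    have e1 := mREMatrix_map (FreeAlgebra.lift K
      (Sum.elim (fun p : ι × ι => N p.1 p.2) fun p => D p.1 p.2)) R ħ (freeN K ι)
    have e2 := derMatrix_map (FreeAlgebra.lift K
      (Sum.elim (fun p : ι × ι => N p.1 p.2) fun p => D p.1 p.2)) R (freeD K ι)
    have e3 := permMatrix_map (FreeAlgebra.lift K
      (Sum.elim (fun p : ι × ι => N p.1 p.2) fun p => D p.1 p.2)) R ħ (freeN K ι) (freeD K ι)
    rw [h1, hN] at e1
    rw [h2, hD] at e2
    rw [h1, h2, hND] at e3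
    rw [map_zero]
    rcases h with rfl | rfl | rfl
    exacts [congrFun (congrFun e1 a) b, congrFun (congrFun e2 a) b, congrFun (congrFun e3 a) b]⟩

section WeylLift

variable {A : Type*} [Ring A] [Algebra K A] {N D : Matrix ι ι A}
    (hN : mREMatrix R ħ N = 0) (hD : derMatrix R D = 0) (hND : permMatrix R ħ N D = 0)

theorem weylLift_weylN (i j : ι) : weylLift hN hD hND (weylN R ħ i j) = N i j := by
  rw [weylN, Matrix.map_apply, weylLift, RingQuot.liftAlgHom_mkAlgHom_apply, freeN,
    FreeAlgebra.lift_ι_apply, Sum.elim_inl]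

theorem weylLift_weylD (i j : ι) : weylLift hN hD hND (weylD R ħ i j) = D i j := by
  rw [weylD, Matrix.map_apply, weylLift, RingQuot.liftAlgHom_mkAlgHom_apply, freeD,
    FreeAlgebra.lift_ι_apply, Sum.elim_inr]

end WeylLift

theorem inclN_mreN (i j : ι) : inclN R ħ (mreN R ħ i j) = weylN R ħ i j := mRELift_mreN _ _ i j

theorem inclD_derD (i j : ι) : inclD R ħ (derD R i j) = weylD R ħ i j := derLift_derD _ _ i j

theorem counit_derD (i j : ι) : counit R (derD R i j) = 0 := derLift_derD _ _ i j

theorem weylMul_tmul (f : MREAlg R ħ) (x : DerAlg R) :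
    weylMul R ħ (f ⊗ₜ x) = inclN R ħ f * inclD R ħ x := rfl

/-- Acting on `1 ⊗ 1` is a left inverse of the multiplication map. -/
theorem weylMul_injective (hq : q ≠ 0) (hR : IsHeckeSymmetry R q) (hΨ : IsSkewInverse R Ψ) :
    Function.Injective (weylMul R ħ) := by
  have hX := shiftX_rel (ħ := ħ) hq hR hΨ
  have hN : mREMatrix R ħ (opN R ħ) = 0 := by
    rw [opN, ← mREMatrix_map, mreN_rel]
    refine Matrix.ext fun _ _ => ?_
    rw [Matrix.map_apply, Matrix.zero_apply, map_zero]
    rfl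
  let ρ := weylLift hN (op_der hq hR hΨ hX) (op_perm hR hΨ hX)
  have h1 (f : MREAlg R ħ) : ρ (inclN R ħ f) = leftOp R ħ f := by
    refine mre_induction (C := fun f => ρ (inclN R ħ f) = leftOp R ħ f) ?_ (fun f g hf hg => ?_)
      (fun c f hf => ?_) (fun i j f hf => ?_) f
    · rw [map_one, map_one, map_one]
    · rw [map_add, map_add, map_add, hf, hg]
    · rw [map_smul, map_smul, map_smul, hf]
    · rw [map_mul, map_mul, map_mul, hf, inclN_mreN, weylLift_weylN]
      rfl
  have h2 (x : DerAlg R) : ρ (inclD R ħ x) (1 ⊗ₜ 1) = 1 ⊗ₜ x := by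
    refine der_induction (C := fun x => ρ (inclD R ħ x) (1 ⊗ₜ 1) = 1 ⊗ₜ x) ?_
      (fun f g hf hg => ?_) (fun c f hf => ?_) (fun i j f hf => ?_) x
    · rw [map_one, map_one, Module.End.one_apply]
    · rw [map_add, map_add, LinearMap.add_apply, hf, hg, TensorProduct.tmul_add]
    · rw [map_smul, map_smul, LinearMap.smul_apply, hf, TensorProduct.tmul_smul]
    · rw [map_mul, map_mul, Module.End.mul_apply, hf, inclD_derD, weylLift_weylD, opD_one_tmul]
  have h3 (t : MREAlg R ħ ⊗[K] DerAlg R) : ρ (weylMul R ħ t) (1 ⊗ₜ 1) = t := by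
    induction t using TensorProduct.induction_on with
    | zero => rw [map_zero, map_zero, LinearMap.zero_apply]
    | tmul f x =>
      rw [weylMul_tmul, map_mul, Module.End.mul_apply, h2, h1, leftOp_tmul, mul_one]
    | add s t hs ht => rw [map_add, map_add, LinearMap.add_apply, hs, ht]
  exact Function.LeftInverse.injective (g := fun w => ρ w (1 ⊗ₜ 1)) h3

end Representation
-- The products `f x` span the braided Weyl algebra.
section Spanning

variable {K : Type*} [Field K] {ι : Type*} [Fintype ι] [DecidableEq ι]
  {R Ψ : Matrix (ι × ι) (ι × ι) K} {q ħ : K}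

theorem weyl_perm' (hR : IsHeckeSymmetry R q) :
    leg1 (weylD R ħ) * scal _ R * leg1 (weylN R ħ) =
      scal _ R * (leg1 (weylN R ħ) * scal _ R⁻¹ * leg1 (weylD R ħ)) * scal _ R⁻¹ + 1 +
        ħ • leg1 (weylD R ħ) := by
  have h1 : scal (WeylAlg R ħ) R * scal _ R⁻¹ = 1 := by
    rw [← scal_mul, Matrix.mul_nonsing_inv R hR.isUnit_det, scal_one]
  have h := congrArg (· * scal (WeylAlg R ħ) R⁻¹) (weyl_perm R ħ)
  simp only [permMatrix, sub_mul, smul_mul_assoc, zero_mul, mul_assoc, h1, mul_one] at h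
  simp only [mul_assoc]
  rw [sub_sub, sub_sub, sub_eq_zero] at h
  rw [h, add_assoc]

theorem mul_weylMul (f : MREAlg R ħ) (t : MREAlg R ħ ⊗[K] DerAlg R) :
    inclN R ħ f * weylMul R ħ t = weylMul R ħ (LinearMap.rTensor _ (LinearMap.mulLeft K f) t) := by
  induction t using TensorProduct.induction_on with
  | zero => simp
  | tmul g x =>
    rw [LinearMap.rTensor_tmul, weylMul_tmul, weylMul_tmul, LinearMap.mulLeft_apply, map_mul,
      mul_assoc]
  | add s t hs ht => rw [map_add, mul_add, hs, ht, map_add, map_add]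

theorem weylMul_mul (t : MREAlg R ħ ⊗[K] DerAlg R) (x : DerAlg R) :
    weylMul R ħ t * inclD R ħ x = weylMul R ħ (LinearMap.lTensor _ (LinearMap.mulRight K x) t) := by
  induction t using TensorProduct.induction_on with
  | zero => simp
  | tmul g y =>
    rw [LinearMap.lTensor_tmul, weylMul_tmul, weylMul_tmul, LinearMap.mulRight_apply, map_mul,
      mul_assoc]
  | add s t hs ht => rw [map_add, add_mul, hs, ht, map_add, map_add]

theorem derivative_mul_mem_range (hR : IsHeckeSymmetry R q) (hΨ : IsSkewInverse R Ψ)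
    (f : MREAlg R ħ) (i j : ι) :
    weylD R ħ i j * inclN R ħ f ∈ LinearMap.range (weylMul R ħ) := by
  revert i j
  refine mre_induction (C := fun f => ∀ i j, weylD R ħ i j * inclN R ħ f ∈
    LinearMap.range (weylMul R ħ)) (fun i j => ?_) (fun f g hf hg i j => ?_)
    (fun c f hf i j => ?_) (fun k l f hf i j => ?_) f
  · refine ⟨1 ⊗ₜ derD R i j, ?_⟩
    rw [weylMul_tmul, map_one, one_mul, mul_one, inclD_derD]
  · rw [map_add, mul_add]
    exact add_mem (hf i j) (hg i j)
  · rw [map_smul, mul_smul_comm]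
    exact Submodule.smul_mem _ c (hf i j)
  · have hN (i j : ι) {w : WeylAlg R ħ} (hw : w ∈ LinearMap.range (weylMul R ħ)) :
        weylN R ħ i j * w ∈ LinearMap.range (weylMul R ħ) := by
      obtain ⟨t, rfl⟩ := hw
      rw [← inclN_mreN, mul_weylMul]
      exact LinearMap.mem_range_self _ _
    -- `J` consists of the `w` for which `w f` is a sum of ordered products. The permutation
    -- relations put the contracted products of derivatives and generators in `J`, and
    -- skew-invertibility then gives the individual ones.
    let J := (LinearMap.range (weylMul R ħ)).comap (LinearMap.mulRight K (inclN R ħ f))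
    have h1 (x y : ι × ι) : (leg1 (weylD R ħ) * scal (WeylAlg R ħ) R *
        leg1 (weylN R ħ)) x y ∈ J := by
      rw [weyl_perm' hR, Matrix.add_apply, Matrix.add_apply, Matrix.smul_apply, mul_scal_apply]
      refine add_mem (add_mem (sum_mem fun z _ => Submodule.smul_mem _ _ ?_) ?_)
        (Submodule.smul_mem _ _ ?_)
      · rw [scal_mul_apply]
        refine sum_mem fun z _ => Submodule.smul_mem _ _ ?_
        rw [sandwich_apply]
        refine sum_mem fun a _ => sum_mem fun b _ => Submodule.smul_mem _ _ ?_
        rw [Submodule.mem_comap, LinearMap.mulRight_apply, mul_assoc]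
        exact hN _ _ (hf _ _)
      · rw [Matrix.one_apply]
        split_ifs
        · rw [Submodule.mem_comap, LinearMap.mulRight_apply, one_mul]
          exact ⟨f ⊗ₜ 1, by rw [weylMul_tmul, map_one, mul_one]⟩
        · exact zero_mem _
      · rw [leg1_apply]
        split_ifs
        · exact hf _ _
        · exact zero_mem _
    have h2 (a b : ι) := hΨ.mem_of_sum_mem J (fun a b => weylD R ħ i a * weylN R ħ b l)
      (fun x y => by rw [← sandwich_apply (x := (i, x)) (y := (l, y))]; exact h1 _ _) a b
    have h3 := h2 j k
    rw [Submodule.mem_comap, LinearMap.mulRight_apply, mul_assoc] at h3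
    rwa [map_mul, inclN_mreN]

theorem weylMul_surjective (hR : IsHeckeSymmetry R q) (hΨ : IsSkewInverse R Ψ) :
    Function.Surjective (weylMul R ħ) := by
  have hD (i j : ι) (t : MREAlg R ħ ⊗[K] DerAlg R) :
      weylD R ħ i j * weylMul R ħ t ∈ LinearMap.range (weylMul R ħ) := by
    induction t using TensorProduct.induction_on with
    | zero => simp
    | tmul g y =>
      obtain ⟨t, ht⟩ := derivative_mul_mem_range (ħ := ħ) hR hΨ g i j
      rw [weylMul_tmul, ← mul_assoc, ← ht, weylMul_mul]
      exact LinearMap.mem_range_self _ _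
    | add s t hs ht =>
      rw [map_add, mul_add]
      exact add_mem hs ht
  intro w
  refine ringQuot_induction (weylRel R ħ) (C := fun w => w ∈ LinearMap.range (weylMul R ħ))
    ⟨1 ⊗ₜ 1, by rw [weylMul_tmul, map_one, map_one, one_mul]⟩ (fun f g => add_mem)
    (fun c f => Submodule.smul_mem _ c) ?_ w
  rintro (⟨i, j⟩ | ⟨i, j⟩) _ ⟨t, rfl⟩
  · refine ⟨_, (mul_weylMul (mreN R ħ i j) t).symm.trans ?_⟩
    rw [inclN_mreN]
    rfl
  · exact hD i j t

end Spanning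
-- Iterated partial derivatives modulo the left ideal generated by the derivatives.
section Counit

variable {K : Type*} [Field K] {ι : Type*} [Fintype ι] [DecidableEq ι]
  {R Ψ : Matrix (ι × ι) (ι × ι) K} {q ħ : K}

/-- The projection of the braided Weyl algebra onto `N(q, ħ)` along the left ideal generated by
the derivatives. -/
noncomputable def weylProj (hW : Function.Bijective (weylMul R ħ)) :
    WeylAlg R ħ →ₗ[K] MREAlg R ħ :=
  (TensorProduct.rid K (MREAlg R ħ)).toLinearMap ∘ₗ
    LinearMap.lTensor (MREAlg R ħ) (counit R).toLinearMap ∘ₗ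
    (LinearEquiv.ofBijective (weylMul R ħ) hW).symm.toLinearMap

variable (hW : Function.Bijective (weylMul R ħ))

theorem braidedPartial_apply (i j : ι) (f : MREAlg R ħ) :
    braidedPartial R ħ hW i j f = weylProj hW (weylD R ħ i j * inclN R ħ f) := rfl

theorem weylProj_mul (f : MREAlg R ħ) (x : DerAlg R) :
    weylProj hW (inclN R ħ f * inclD R ħ x) = counit R x • f := by
  rw [← weylMul_tmul, weylProj, LinearMap.comp_apply, LinearMap.comp_apply,
    LinearEquiv.coe_coe, LinearEquiv.coe_coe,
    show weylMul R ħ (f ⊗ₜ x) = LinearEquiv.ofBijective (weylMul R ħ) hW (f ⊗ₜ x) from rfl,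
    LinearEquiv.symm_apply_apply, LinearMap.lTensor_tmul, TensorProduct.rid_tmul]
  rfl

/-- To check a property of all elements of the braided Weyl algebra, it suffices to consider the
products `f x`. -/
theorem weyl_induction {C : WeylAlg R ħ → Prop} (hW : Function.Bijective (weylMul R ħ))
    (mul : ∀ f x, C (inclN R ħ f * inclD R ħ x)) (add : ∀ v w, C v → C w → C (v + w))
    (w : WeylAlg R ħ) : C w := by
  obtain ⟨t, rfl⟩ := hW.2 w
  induction t using TensorProduct.induction_on with
  | zero => simpa using mul 0 0
  | tmul f x => exact mul f x
  | add s t hs ht =>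
    rw [map_add]
    exact add _ _ hs ht

theorem weylProj_mul_inclD (w : WeylAlg R ħ) (x : DerAlg R) :
    weylProj hW (w * inclD R ħ x) = counit R x • weylProj hW w := by
  refine weyl_induction (C := fun w => weylProj hW (w * inclD R ħ x) =
    counit R x • weylProj hW w) hW (fun f y => ?_) (fun v w hv hw => ?_) w
  · rw [mul_assoc, ← map_mul, weylProj_mul, weylProj_mul, map_mul, mul_comm, mul_smul]
  · rw [add_mul, map_add, map_add, smul_add, hv, hw]

/-- Thus the kernel of `weylProj` is a left ideal, and composing partial derivatives amounts to
multiplying them in `𝒲` before projecting. -/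
theorem weylProj_mul_weylProj (v w : WeylAlg R ħ) :
    weylProj hW (v * inclN R ħ (weylProj hW w)) = weylProj hW (v * w) := by
  refine weyl_induction (C := fun w => weylProj hW (v * inclN R ħ (weylProj hW w)) =
    weylProj hW (v * w)) hW (fun f y => ?_) (fun w w' hw hw' => ?_) w
  · rw [weylProj_mul, map_smul, mul_smul_comm, map_smul, ← mul_assoc, weylProj_mul_inclD]
  · rw [map_add, map_add, mul_add, map_add, hw, hw', mul_add, map_add]

/-- The left ideal generated by the derivatives, as the kernel of `weylProj`. -/
noncomputable def weylKer : Submodule (WeylAlg R ħ) (WeylAlg R ħ) where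
  carrier := {w | weylProj hW w = 0}
  add_mem' {v w} hv hw := by
    rw [Set.mem_ofPred_eq] at *
    rw [map_add, hv, hw, add_zero]
  zero_mem' := map_zero _
  smul_mem' v w hw := by
    rw [Set.mem_ofPred_eq] at *
    rw [smul_eq_mul, ← weylProj_mul_weylProj, hw, map_zero, mul_zero, map_zero]

theorem mem_weylKer (w : WeylAlg R ħ) : w ∈ weylKer hW ↔ weylProj hW w = 0 := Iff.rfl

theorem partial_partial (i j k l : ι) (f : MREAlg R ħ) :
    braidedPartial R ħ hW i j (braidedPartial R ħ hW k l f) =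
      weylProj hW (weylD R ħ i j * weylD R ħ k l * inclN R ħ f) := by
  rw [braidedPartial_apply, braidedPartial_apply, weylProj_mul_weylProj, mul_assoc]

theorem derProd_mem (hq : q ≠ 0) (hR : IsHeckeSymmetry R q) (hΨ : IsSkewInverse R Ψ)
    (f : MREAlg R ħ) : ∃ X : Matrix (ι × ι) (ι × ι) (WeylAlg R ħ),
    EntriesIn (weylKer hW) (leg1 (weylD R ħ) * scal _ R⁻¹ * leg1 (weylD R ħ) *
      diagElt _ (inclN R ħ f) - (X + scal _ R * X * scal _ R)) := by
  refine mre_induction (C := fun f => ∃ X : Matrix (ι × ι) (ι × ι) (WeylAlg R ħ),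
    EntriesIn (weylKer hW) (leg1 (weylD R ħ) * scal _ R⁻¹ * leg1 (weylD R ħ) *
      diagElt _ (inclN R ħ f) - (X + scal _ R * X * scal _ R))) ?_ ?_ ?_ ?_ f
  -- For `f = 1` every entry is a combination of products ending in a derivative, so `X = 0` works.
  · refine ⟨0, fun x y => ?_⟩
    rw [mul_zero, zero_mul, add_zero, sub_zero, mul_diagElt_apply, map_one, mul_one,
      sandwich_apply]
    refine sum_mem fun a _ => sum_mem fun b _ => Submodule.smul_of_tower_mem _ _ ?_
    rw [mem_weylKer, ← inclD_derD b y.1, weylProj_mul_inclD, counit_derD, zero_smul]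
  · rintro f g ⟨X, hX⟩ ⟨X', hX'⟩
    refine ⟨X + X', ?_⟩
    have h : leg1 (weylD R ħ) * scal _ R⁻¹ * leg1 (weylD R ħ) * diagElt _ (inclN R ħ (f + g)) =
        leg1 (weylD R ħ) * scal _ R⁻¹ * leg1 (weylD R ħ) * diagElt _ (inclN R ħ f) +
        leg1 (weylD R ħ) * scal _ R⁻¹ * leg1 (weylD R ħ) * diagElt _ (inclN R ħ g) := by
      ext x y
      simp only [Matrix.add_apply, mul_diagElt_apply, map_add, mul_add]
    convert hX.add hX' using 1
    rw [h]
    noncomm_ring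
  · rintro c f ⟨X, hX⟩
    refine ⟨c • X, ?_⟩
    have h : leg1 (weylD R ħ) * scal _ R⁻¹ * leg1 (weylD R ħ) * diagElt _ (inclN R ħ (c • f)) =
        c • (leg1 (weylD R ħ) * scal _ R⁻¹ * leg1 (weylD R ħ) * diagElt _ (inclN R ħ f)) := by
      ext x y
      simp only [Matrix.smul_apply, mul_diagElt_apply, map_smul, mul_smul_comm]
    convert hX.smul c using 1
    rw [h, mul_smul_comm, smul_mul_assoc, smul_sub, smul_add]
  · rintro i j f hf
    rw [map_mul, inclN_mreN]
    exact derProd_mul_mem hq hR hΨ (weyl_perm R ħ) _ _ hf i j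

end Counit

/-! ### The trace pairing of matrices over two algebras. -/

section Pairing

variable {K : Type*} [Field K] {n : Type*} [Fintype n] {ι : Type*} [Fintype ι] [DecidableEq ι]
  {E N : Type*} [Ring E] [Algebra K E] [Ring N] [Algebra K N]

/-- The trace of a product of matrices with entries in two algebras, with values in the tensor
product of the algebras. -/
def tensorTrace (K : Type*) [Field K] [Algebra K E] [Algebra K N]
    (Y : Matrix n n E) (Z : Matrix n n N) : E ⊗[K] N :=
  ∑ x, ∑ y, Y x y ⊗ₜ Z y x

theorem tensorTrace_scal_mul (S : Matrix n n K) (Y : Matrix n n E) (Z : Matrix n n N) :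
    tensorTrace K (scal E S * Y) Z = tensorTrace K Y (Z * scal N S) := by
  simp only [tensorTrace, scal_mul_apply, mul_scal_apply, TensorProduct.sum_tmul,
    TensorProduct.tmul_sum, TensorProduct.smul_tmul]
  rw [Finset.sum_congr rfl fun x _ => Finset.sum_comm, Finset.sum_comm]
  exact Finset.sum_congr rfl fun x _ => Finset.sum_comm

theorem tensorTrace_mul_scal (S : Matrix n n K) (Y : Matrix n n E) (Z : Matrix n n N) :
    tensorTrace K (Y * scal E S) Z = tensorTrace K Y (scal N S * Z) := by
  simp only [tensorTrace, scal_mul_apply, mul_scal_apply, TensorProduct.sum_tmul,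
    TensorProduct.tmul_sum, TensorProduct.smul_tmul]
  exact Finset.sum_congr rfl fun x _ => Finset.sum_comm

/-- Scalar matrices move cyclically through the trace, so `X ↦ X + R X R` is its own adjoint. -/
theorem tensorTrace_eq_zero {R : Matrix n n K} {Y : Matrix n n E}
    (hY : Y + scal E R * Y * scal E R = 0) (X : Matrix n n N) :
    tensorTrace K Y (X + scal N R * X * scal N R) = 0 := by
  have h1 : tensorTrace K Y (X + scal N R * X * scal N R) =
      tensorTrace K Y X + tensorTrace K Y (scal N R * X * scal N R) := by
    simp only [tensorTrace, Matrix.add_apply, TensorProduct.tmul_add, Finset.sum_add_distrib]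
  have h2 : tensorTrace K (Y + scal E R * Y * scal E R) X =
      tensorTrace K Y X + tensorTrace K (scal E R * Y * scal E R) X := by
    simp only [tensorTrace, Matrix.add_apply, TensorProduct.add_tmul, Finset.sum_add_distrib]
  rw [h1, ← tensorTrace_scal_mul, ← tensorTrace_mul_scal, ← h2, hY]
  simp [tensorTrace]

end Pairing
-- The exterior algebra and `d² = 0`.
section Forms

variable {K : Type*} [Field K] {ι : Type*} [Fintype ι] [DecidableEq ι]
  {R Ψ : Matrix (ι × ι) (ι × ι) K} {q ħ : K}

theorem skewMatrix_map {A A' : Type*} [Ring A] [Algebra K A] [Ring A'] [Algebra K A']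
    (φ : A →ₐ[K] A') (R Ψh : Matrix (ι × ι) (ι × ι) K) (Ω : Matrix ι ι A) :
    (skewMatrix R Ψh Ω).map φ = skewMatrix R Ψh (Ω.map φ) := by
  have h : ∀ M : Matrix (ι × ι) (ι × ι) A, M.map φ = φ.mapMatrix M := fun _ => rfl
  have h1 := leg1_map φ Ω
  have h2 := scal_map φ R
  have h3 := scal_map φ R⁻¹
  have h4 := scal_map φ Ψh
  rw [h] at h1 h2 h3 h4
  rw [h, skewMatrix, skewMatrix]
  simp only [map_add, map_mul, h1, h2, h3, h4]

theorem skewMatrix_Omega : skewMatrix R (hatPsi Ψ q) (Omega R Ψ q) = 0 := by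
  have h : Omega R Ψ q = (scal _ (opB Ψ)⁻¹ * freeGen K ι).map
      (RingQuot.mkAlgHom K (extRel R Ψ q)) := by
    ext i j
    simp [Omega, dn, scal_mul_apply]
  rw [h, ← skewMatrix_map]
  ext a b
  rw [Matrix.map_apply, Matrix.zero_apply, ← map_zero (RingQuot.mkAlgHom K (extRel R Ψ q))]
  exact RingQuot.mkAlgHom_rel K ⟨rfl, a, b, rfl⟩

/-- The defining relation multiplied by `R` on the right, in the form required by
`tensorTrace_eq_zero`. -/
theorem Omega_skew (hR : IsHeckeSymmetry R q) :
    leg1 (Omega R Ψ q) * scal _ (hatPsi Ψ q) * leg1 (Omega R Ψ q) +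
      scal _ R * (leg1 (Omega R Ψ q) * scal _ (hatPsi Ψ q) * leg1 (Omega R Ψ q)) * scal _ R =
      0 := by
  have h1 : scal (ExtAlg R Ψ q) R⁻¹ * scal _ R = 1 := by
    rw [← scal_mul, Matrix.nonsing_inv_mul R hR.isUnit_det, scal_one]
  have h := congrArg (· * scal (ExtAlg R Ψ q) R) (skewMatrix_Omega (R := R) (Ψ := Ψ) (q := q))
  simp only [skewMatrix, add_mul, zero_mul, mul_assoc, h1, mul_one] at h
  rw [add_comm]
  simpa only [mul_assoc] using h

theorem hatPsi_contract (hR : IsHeckeSymmetry R q) (hΨ : IsSkewInverse R Ψ) (hq : q ≠ 0)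
    (hB : IsUnit (opB Ψ)) {U V : Type*} [AddCommGroup U] [Module K U] [AddCommGroup V]
    [Module K V] (u : ι × ι → U) (v : ι × ι → V) :
    ∑ p : ι × ι, (∑ s, hatPsi Ψ q (s.1, p.1) (s.2, p.2) • u s) ⊗ₜ[K]
      (∑ t, R⁻¹ (t.1, p.2) (t.2, p.1) • v t) = ∑ s, u s ⊗ₜ[K] v s.swap := by
  simp only [TensorProduct.sum_tmul, TensorProduct.tmul_sum, TensorProduct.smul_tmul_smul]
  rw [Finset.sum_comm, Finset.sum_congr rfl fun t _ => Finset.sum_comm, Finset.sum_comm]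
  refine Finset.sum_congr rfl fun s _ => ?_
  simp only [← Finset.sum_smul]
  have h (t : ι × ι) : ∑ p : ι × ι, hatPsi Ψ q (s.1, p.1) (s.2, p.2) *
      R⁻¹ (t.1, p.2) (t.2, p.1) = if t = s.swap then 1 else 0 := by
    rw [Fintype.sum_prod_type, hatPsi_sum hΨ hR hq hB]
    simp only [Prod.ext_iff, Prod.fst_swap, Prod.snd_swap, eq_comm (a := s.1), and_comm]
  refine (Finset.sum_congr rfl fun t _ => congrArg (· • u s ⊗ₜ[K] v t) (h t)).trans ?_
  simp

/-- The second-factor indices of the trace contract `Ψ̂` with `R⁻¹`; by `hatPsi_sum` this leaves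
only Kronecker deltas, which join each `Ω` to its derivative. -/
theorem tensorTrace_hatPsi (hR : IsHeckeSymmetry R q) (hΨ : IsSkewInverse R Ψ) (hq : q ≠ 0)
    (hB : IsUnit (opB Ψ)) {E A N : Type*} [Ring E] [Algebra K E] [Ring A] [Algebra K A]
    [Ring N] [Algebra K N] (Ω : Matrix ι ι E) (D : Matrix ι ι A) (φ : A →ₗ[K] N) :
    tensorTrace K (leg1 Ω * scal E (hatPsi Ψ q) * leg1 Ω)
        ((leg1 D * scal A R⁻¹ * leg1 D).map φ) =
      ∑ i, ∑ j, ∑ k, ∑ l, (Ω i j * Ω k l) ⊗ₜ[K] φ (D l k * D j i) := by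
  have h (i l : ι) := hatPsi_contract hR hΨ hq hB (fun s => Ω i s.1 * Ω s.2 l)
    (fun t => φ (D l t.1 * D t.2 i))
  simp only [Fintype.sum_prod_type, Prod.swap_prod_mk] at h
  simp only [tensorTrace, Matrix.map_apply, sandwich_apply, map_sum, map_smul,
    Fintype.sum_prod_type]
  rw [Finset.sum_congr rfl fun i _ => Finset.sum_comm]
  simp only [h]
  refine Finset.sum_congr rfl fun i _ => ?_
  rw [Finset.sum_comm]
  exact Finset.sum_congr rfl fun j _ => Finset.sum_comm

theorem Omega_mul_Omega_partial (hq : q ≠ 0) (hR : IsHeckeSymmetry R q)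
    (hΨ : IsSkewInverse R Ψ) (hB : IsUnit (opB Ψ)) (hW : Function.Bijective (weylMul R ħ))
    (f : MREAlg R ħ) :
    ∑ i, ∑ j, ∑ k, ∑ l, (Omega R Ψ q i j * Omega R Ψ q k l) ⊗ₜ[K]
      braidedPartial R ħ hW l k (braidedPartial R ħ hW j i f) = 0 := by
  obtain ⟨X, hX⟩ := derProd_mem hW hq hR hΨ f
  have h1 : (leg1 (weylD R ħ) * scal _ R⁻¹ * leg1 (weylD R ħ)).map
      (weylProj hW ∘ₗ LinearMap.mulRight K (inclN R ħ f)) =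
      X.map (weylProj hW) + scal _ R * X.map (weylProj hW) * scal _ R := by
    rw [← map_scal_mul, ← map_mul_scal]
    ext x y
    have h := hX x y
    rw [mem_weylKer, Matrix.sub_apply, map_sub, sub_eq_zero, Matrix.add_apply, map_add,
      mul_diagElt_apply] at h
    exact h
  simp only [partial_partial]
  refine (tensorTrace_hatPsi hR hΨ hq hB (Omega R Ψ q) (weylD R ħ)
    (weylProj hW ∘ₗ LinearMap.mulRight K (inclN R ħ f))).symm.trans ?_
  rw [h1]
  exact tensorTrace_eq_zero (Omega_skew hR) _

theorem deRham_comp_deRham (hq : q ≠ 0) (hR : IsHeckeSymmetry R q)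
    (hΨ : IsSkewInverse R Ψ) (hB : IsUnit (opB Ψ)) (hW : Function.Bijective (weylMul R ħ))
    (k : ℕ) : deRham R Ψ q ħ hW (k + 1) ∘ₗ deRham R Ψ q ħ hW k = 0 := by
  refine TensorProduct.ext' fun ω f => ?_
  have h := congrArg (LinearMap.rTensor (MREAlg R ħ) (LinearMap.mulLeft K (ω : ExtAlg R Ψ q)))
    (Omega_mul_Omega_partial hq hR hΨ hB hW f)
  simp only [map_sum, LinearMap.rTensor_tmul, LinearMap.mulLeft_apply, ← mul_assoc] at h
  -- The identity is known in the full exterior algebra tensored with `𝒩`; flatness over the field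
  -- makes the inclusion of the component of degree `k + 2` injective after tensoring.
  refine Module.Flat.rTensor_preserves_injective_linearMap (M := MREAlg R ħ)
    (extPart R Ψ q (k + 1 + 1)).subtype (Submodule.subtype_injective _) (Eq.trans ?_ h)
  simp only [deRham, LinearMap.comp_apply, LinearMap.sum_apply, TensorProduct.map_tmul, map_sum,
    LinearMap.rTensor_tmul]
  rfl

end Forms
end BraidedDeRham

theorem mainTheorem1 {K : Type*} [Field K] (m : ℕ)
    (R Ψ : Matrix (Fin m × Fin m) (Fin m × Fin m) K) (q ħ : K) (hq : q ≠ 0)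
    (hR : BraidedDeRham.IsHeckeSymmetry R q) (hΨ : BraidedDeRham.IsSkewInverse R Ψ)
    (hB : IsUnit (BraidedDeRham.opB Ψ)) :
    ∃ hW : Function.Bijective (BraidedDeRham.weylMul R ħ), ∀ k : ℕ,
      BraidedDeRham.deRham R Ψ q ħ hW (k + 1) ∘ₗ BraidedDeRham.deRham R Ψ q ħ hW k = 0 :=
  ⟨⟨BraidedDeRham.weylMul_injective hq hR hΨ, BraidedDeRham.weylMul_surjective hR hΨ⟩,
    fun k => BraidedDeRham.deRham_comp_deRham hq hR hΨ hB _ k⟩
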